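/- Let $\alpha\in(0,1)$ and $c_1>0$. For $0\le y\le c_1$ put $$G_{c_1}(y)=\frac1{\Gamma(1-\alpha)}\int_y^{c_1}\bigl(1-c_1^{-2/\alpha}\mu^{2/\alpha}\bigr)^{-\alpha}\,d\mu ,$$ and for $0\le y\le p$ (respectively $0\le x\le p$) put $$M_1(p,y)=\frac1{\Gamma(1-\alpha)}\int_y^{p}\bigl(1-p^{-2/\alpha}\mu^{2/\alpha}\bigr)^{-\alpha}\,d\mu ,\qquad M_n(p,y)=\int_y^p M_1(a,y)M_{n-1}(p,a)\,da\quad(n\ge 2),$$ $$N(p,y)=\sum_{n=1}^\infty M_n(p,y),\qquad H(p,x)=1+\int_x^pN(p,y)\,dy .$$ Let $$\gamma=\int_0^{c_1}H(p,0)\,G_{c_1}(p)\,dp ,\qquad s(t)=c_1t^{\alpha/2}\quad (t\ge 0),$$ $$u(x,t)=\int_{xt^{-\alpha/2}}^{c_1}H\bigl(p,xt^{-\alpha/2}\bigr)\,G_{c_1}(p)\,dp\qquad (t>0,\ 0\le x\le s(t)).$$ Then all these integrals and the series converge, and $(u,s)$ is a solution of the one-phase time-fractional Stefan problem in $U=\{(x,t):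 t>0,\ 0<x<s(t)\}$ with the positive constant Dirichlet datum $\gamma$. That is: $\gamma>0$; $s(0)=0$, $s$ is continuous on $[0,\infty)$ and differentiable with $\dot s>0$ on $(0,\infty)$; $u$ is continuous on $\{(x,t): t>0,\ 0\le x\le s(t)\}$; the derivatives $u_t,u_x,u_{xx}$ exist in $U$; the integrals below converge and the time derivative on the right-hand side of the last condition exists at every point $(a,t)\in U$; and $$\frac1{\Gamma(1-\alpha)}\int_{s^{-1}(x)}^t(t-\tau)^{-\alpha}u_t(x,\tau)\,d\tau=u_{xx}(x,t)-\frac1{\Gamma(1-\alpha)}\bigl(t-s^{-1}(x)\bigr)^{-\alpha}\quad\text{for all }(x,t)\in U,$$ $$u(s(t),t)=0,\qquad u(0,t)=\gamma\qquad\text{for all }t>0,$$ $$\dot s(t)=-\frac1{\Gamma(\alpha)}\lim_{a\nearrow s(t)}\frac{d}{dt}\left[\int_{s^{-1}(a)}^t(t-\tau)^{\alpha-1}u_x(a,\tau)\,d\tau\right]\qquad\text{for all }t>0 .$$ -/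

import Mathlib

noncomputable section

namespace FractionalStefan

open MeasureTheory Filter Topology

/-- The Caputo derivative of order `α`, based at `a`:
`1/Γ(1-α) ∫_a^t (t-τ)^(-α) f'(τ) dτ`. -/
def caputo (α a : ℝ) (f : ℝ → ℝ) (t : ℝ) : ℝ :=
  1 / Real.Gamma (1 - α) * ∫ τ in a..t, (t - τ) ^ (-α) * deriv f τ

/-- The inverse `s⁻¹` of an interface curve `s : [0,∞) → ℝ`. -/
def curveInv (s : ℝ → ℝ) : ℝ → ℝ := Function.invFunOn s (Set.Ici 0)

/-- Space derivative `u_x`. -/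
def dx (u : ℝ → ℝ → ℝ) (x t : ℝ) : ℝ := deriv (fun y => u y t) x

/-- The expression `∫_{s⁻¹(a)}^t (t-τ)^(α-1) u_x(a,τ) dτ`. -/
def fluxIntegral (α : ℝ) (u : ℝ → ℝ → ℝ) (s : ℝ → ℝ) (a t : ℝ) : ℝ :=
  ∫ τ in (curveInv s a)..t, (t - τ) ^ (α - 1) * dx u a τ

/-- `(u, s)` solves the one-phase fractional Stefan problem of order `α` with `s(0) = 0` and the
positive constant Dirichlet datum `γ`. The liquid region is `U = {(x,t) : 0 < t, 0 < x < s t}`.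
All derivatives and integrals that occur are required to exist. -/
structure IsSolution (α γ : ℝ) (u : ℝ → ℝ → ℝ) (s : ℝ → ℝ) : Prop where
  datum_pos : 0 < γ
  /-- The interface starts at `0`, and it advances. -/
  s_zero : s 0 = 0
  s_cont : ContinuousOn s (Set.Ici 0)
  s_diff : ∀ t, 0 < t → DifferentiableAt ℝ s t
  s_deriv_pos : ∀ t, 0 < t → 0 < deriv s t
  /-- `u` is continuous up to the lateral boundary, where the Dirichlet conditions are posed. -/
  u_cont : ContinuousOn (fun q : ℝ × ℝ => u q.1 q.2) {q | 0 < q.2 ∧ 0 ≤ q.1 ∧ q.1 ≤ s q.2}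
  /-- Existence of `u_t`, `u_x`, `u_xx` in `U`. -/
  u_diff_t : ∀ x t, 0 < t → 0 < x → x < s t → DifferentiableAt ℝ (fun τ => u x τ) t
  u_diff_x : ∀ x t, 0 < t → 0 < x → x < s t → DifferentiableAt ℝ (fun y => u y t) x
  u_diff_xx : ∀ x t, 0 < t → 0 < x → x < s t → DifferentiableAt ℝ (fun y => dx u y t) x
  /-- The integral in the Caputo derivative converges. -/
  caputo_integrable : ∀ x t, 0 < t → 0 < x → x < s t →
    IntervalIntegrable (fun τ => (t - τ) ^ (-α) * deriv (fun r => u x r) τ) volume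
      (curveInv s x) t
  /-- The diffusion equation in `U`. -/
  equation : ∀ x t, 0 < t → 0 < x → x < s t →
    caputo α (curveInv s x) (fun τ => u x τ) t =
      deriv (fun y => dx u y t) x - 1 / Real.Gamma (1 - α) * (t - curveInv s x) ^ (-α)
  /-- The temperature vanishes on the interface. -/
  interface_zero : ∀ t, 0 < t → u (s t) t = 0
  /-- The Dirichlet condition on the fixed boundary. -/
  dirichlet : ∀ t, 0 < t → u 0 t = γ
  /-- The integral in the free boundary condition converges and is differentiable in time. -/
  flux_integrable : ∀ a t, 0 < t → 0 < a → a < s t →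
    IntervalIntegrable (fun τ => (t - τ) ^ (α - 1) * dx u a τ) volume (curveInv s a) t
  flux_diff : ∀ a t, 0 < t → 0 < a → a < s t → DifferentiableAt ℝ (fluxIntegral α u s a) t
  /-- The free boundary condition. -/
  free_boundary : ∀ t, 0 < t →
    Tendsto (fun a => -(1 / Real.Gamma α) * deriv (fluxIntegral α u s a) t)
      (𝓝[<] (s t)) (𝓝 (deriv s t))

/-- The interface `s(t) = c₁ t^(α/2)`. -/
def interfaceCurve (α c₁ t : ℝ) : ℝ := c₁ * t ^ (α / 2)

/-- `G_{c₁}(y) = 1/Γ(1-α) ∫_y^{c₁} (1 - c₁^(-2/α) μ^(2/α))^(-α) dμ`, for `0 ≤ y ≤ c₁`. -/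
def G (α c₁ y : ℝ) : ℝ :=
  1 / Real.Gamma (1 - α) * ∫ μ in y..c₁, (1 - c₁ ^ (-(2 / α)) * μ ^ (2 / α)) ^ (-α)

/-- The iterated kernels, for `0 ≤ y ≤ p`; the index is shifted by one: `M α n` is the kernel
`M_{n+1}`. So `M_1(p,y) = 1/Γ(1-α) ∫_y^p (1 - p^(-2/α) μ^(2/α))^(-α) dμ` is `M α 0 p y`, and
`M_{n+1}(p,y) = ∫_y^p M_1(a,y) M_n(p,a) da`. -/
def M (α : ℝ) : ℕ → ℝ → ℝ → ℝ
  | 0, p, y =>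
      1 / Real.Gamma (1 - α) * ∫ μ in y..p, (1 - p ^ (-(2 / α)) * μ ^ (2 / α)) ^ (-α)
  | n + 1, p, y => ∫ a in y..p, M α 0 a y * M α n p a

/-- `N(p,y) = ∑_{n ≥ 1} M_n(p,y)`. -/
def N (α p y : ℝ) : ℝ := ∑' n : ℕ, M α n p y

/-- `H(p,x) = 1 + ∫_x^p N(p,y) dy`. -/
def H (α p x : ℝ) : ℝ := 1 + ∫ y in x..p, N α p y

/-- `u(x,t) = ∫_{x t^(-α/2)}^{c₁} H(p, x t^(-α/2)) G_{c₁}(p) dp`. -/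
def temperature (α c₁ x t : ℝ) : ℝ :=
  ∫ p in (x * t ^ (-(α / 2)))..c₁, H α p (x * t ^ (-(α / 2))) * G α c₁ p

/-- The integrals and the series in the formulas for `G`, `M`, `N`, `H` and `temperature` all
converge. -/
structure FormulasConverge (α c₁ : ℝ) : Prop where
  /-- The integrals defining `M_1`, and (for `p = c₁`) `G_{c₁}`. -/
  first_kernel : ∀ p y, 0 ≤ y → y ≤ p →
    IntervalIntegrable (fun μ : ℝ => (1 - p ^ (-(2 / α)) * μ ^ (2 / α)) ^ (-α)) volume y p
  kernels : ∀ (n : ℕ) (p y : ℝ), 0 ≤ y → y ≤ p →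
    IntervalIntegrable (fun a => M α 0 a y * M α n p a) volume y p
  series : ∀ p y, 0 ≤ y → y ≤ p → Summable (fun n : ℕ => M α n p y)
  resolvent : ∀ p x, 0 ≤ x → x ≤ p → IntervalIntegrable (fun y => N α p y) volume x p
  profile : ∀ x, 0 ≤ x → x ≤ c₁ →
    IntervalIntegrable (fun p => H α p x * G α c₁ p) volume x c₁

end FractionalStefan

end

noncomputable section

namespace FractionalStefan

open MeasureTheory Filter Topology

/-! The problem is self-similar: `u(x,t) = f(x t^(-α/2))` with `f(z) = ∫_z^c g` and `g = N(c,·)` on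
`[0,c]`, where `c = c₁`. Everything follows from one integral equation for `g`.

The first kernel is homogeneous, `M_1(p,y) = 1/Γ(1-α) ∫_y^p φ(μ/p) dμ` with `φ(r) = (1 -
r^(2/α))^(-α)`, and `N` is its Volterra resolvent. The iterated kernels are powers of one operator,
so `N` satisfies two resolvent equations, with the extra factor `M_1` on either side. One of them,
with Fubini, turns the formula with `H` and `G` into `∫ g` (`integral_H_mul_G`). The other says
`g(y) = M_1(c,y) + ∫ M_1(a,y) g(a) da`; differentiated, it reads `-Γ(1-α) g'(y) = φ(y/c) + ∫_0^c
φ(y/μ) g(μ) dμ` (`hasDerivAt_fluxProfile`).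

This is the diffusion equation. Since `t^(-α) φ((τ/t)^(α/2)) = (t-τ)^(-α)`, the first term is the
source `(t - s⁻¹(x))^(-α)`, and the substitution `μ = x τ^(-α/2)` turns the second into the Caputo
integral (`integral_caputo_explicit`).

For the free boundary condition, time is measured in units of the passage time `τ₀ = s⁻¹(a)`. The
flux integral becomes `-τ₀^(α/2)` times an Abel integral of order `α` of a function `j` with `j(0) =
0` and `j'(s) = s^(-α) q(s)`, where `q(0) = cα/(2Γ(1-α))` comes from the singularity of `φ` at `1`.
As `a ↗ s(t)`, the derivative of the Abel integral tends to `q(0) Γ(α) Γ(1-α)`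
(`tendsto_abelDeriv`), which is exactly the constant needed for `deriv s t`. -/

/-- The weakly singular weight `(1 - r^(2/α))^(-α)` on `(0,1)`, extended by zero. -/
def singularWeight (α : ℝ) : ℝ → ℝ :=
  Set.indicator (Set.Ioo 0 1) fun r => (1 - r ^ (2 / α)) ^ (-α)

/-! ### The weakly singular weight. -/

section Weight

variable {α : ℝ}

lemma singularWeight_nonneg (h₀ : 0 < α) (r : ℝ) : 0 ≤ singularWeight α r := by
  unfold singularWeight
  refine Set.indicator_nonneg (fun r hr => Real.rpow_nonneg ?_ _) r
  have := Real.rpow_le_one hr.1.le hr.2.le (by positivity : 0 ≤ 2 / α)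
  linarith

lemma singularWeight_of_mem {r : ℝ} (hr : r ∈ Set.Ioo (0 : ℝ) 1) :
    singularWeight α r = (1 - r ^ (2 / α)) ^ (-α) :=
  Set.indicator_of_mem hr _

lemma singularWeight_of_one_le {r : ℝ} (hr : 1 ≤ r) : singularWeight α r = 0 :=
  Set.indicator_of_notMem (fun h => absurd h.2 (not_lt.2 hr)) _

lemma rpow_two_div_lt_one (h₀ : 0 < α) {r : ℝ} (hr : r ∈ Set.Ioo (0 : ℝ) 1) :
    r ^ (2 / α) < 1 :=
  Real.rpow_lt_one hr.1.le hr.2 (by positivity)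

lemma singularWeight_pos (h₀ : 0 < α) {r : ℝ} (hr : r ∈ Set.Ioo (0 : ℝ) 1) :
    0 < singularWeight α r := by
  rw [singularWeight_of_mem hr]
  exact Real.rpow_pos_of_pos (by linarith [rpow_two_div_lt_one h₀ hr]) _

/-- As `2/α ≥ 1`, `r^(2/α) ≤ r` on the unit interval. The majorant is integrable because `α < 1`. -/
lemma singularWeight_le (h₀ : 0 < α) (h₁ : α < 1) {r : ℝ} (hr : r ≤ 1) :
    singularWeight α r ≤ (1 - r) ^ (-α) := by
  unfold singularWeight
  refine Set.indicator_apply_le' (fun hr => ?_)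
    (fun _ => Real.rpow_nonneg (by linarith) _)
  refine Real.rpow_le_rpow_of_nonpos (by linarith [hr.2]) ?_ (by linarith)
  have : r ^ (2 / α) ≤ r ^ (1 : ℝ) := by
    refine Real.rpow_le_rpow_of_exponent_ge hr.1 hr.2.le ?_
    rw [le_div_iff₀ h₀]; linarith
  rw [Real.rpow_one] at this
  linarith

lemma measurable_singularWeight : Measurable (singularWeight α) := by
  unfold singularWeight
  exact Measurable.indicator (by fun_prop) measurableSet_Ioo

lemma intervalIntegrable_one_sub_rpow (h₁ : α < 1) (a b : ℝ) :
    IntervalIntegrable (fun r : ℝ => (1 - r) ^ (-α)) volume a b := by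
  have := (intervalIntegral.intervalIntegrable_rpow' (a := 1 - a) (b := 1 - b)
    (by linarith : -1 < -α)).comp_sub_left 1
  simpa using this

lemma integrable_singularWeight (h₀ : 0 < α) (h₁ : α < 1) : Integrable (singularWeight α) := by
  have h : IntegrableOn (singularWeight α) (Set.Ioo 0 1) := by
    have hi : IntegrableOn (fun r : ℝ => (1 - r) ^ (-α)) (Set.Ioo 0 1) :=
      ((intervalIntegrable_iff_integrableOn_Ioo_of_le zero_le_one).1
        (intervalIntegrable_one_sub_rpow h₁ 0 1))
    refine Integrable.mono' hi measurable_singularWeight.aestronglyMeasurable ?_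
    filter_upwards [ae_restrict_mem measurableSet_Ioo] with r hr
    rw [Real.norm_of_nonneg (singularWeight_nonneg h₀ r)]
    exact singularWeight_le h₀ h₁ hr.2.le
  refine (integrableOn_iff_integrable_of_support_subset ?_).1 h
  exact Set.support_indicator_subset

end Weight

/-! ### The first kernel and its homogeneity. -/

/-- The profile `k(w) = 1/Γ(1-α) ∫_w^1 (1 - r^(2/α))^(-α) dr` of the first kernel. -/
def kernelProfile (α w : ℝ) : ℝ :=
  1 / Real.Gamma (1 - α) * ∫ r in w..1, singularWeight α r

section Profile

variable {α : ℝ} (h₀ : 0 < α) (h₁ : α < 1)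
include h₀ h₁

omit h₀ in
lemma inv_Gamma_pos : 0 < 1 / Real.Gamma (1 - α) := by
  have := Real.Gamma_pos_of_pos (by linarith : 0 < 1 - α)
  positivity

lemma continuous_kernelProfile : Continuous (kernelProfile α) := by
  unfold kernelProfile
  simp_rw [intervalIntegral.integral_symm 1]
  have := intervalIntegral.continuous_primitive
    (fun a b => (integrable_singularWeight h₀ h₁).intervalIntegrable (a := a) (b := b)) 1
  fun_prop

omit h₀ h₁ in
lemma kernelProfile_of_one_le {w : ℝ} (hw : 1 ≤ w) : kernelProfile α w = 0 := by
  unfold kernelProfile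
  rw [intervalIntegral.integral_symm, intervalIntegral.integral_congr (g := fun _ => (0 : ℝ))]
  · simp
  · intro r hr
    rw [Set.uIcc_of_le hw] at hr
    exact singularWeight_of_one_le hr.1

lemma kernelProfile_nonneg (w : ℝ) : 0 ≤ kernelProfile α w := by
  rcases le_total 1 w with hw | hw
  · rw [kernelProfile_of_one_le hw]
  · exact mul_nonneg (inv_Gamma_pos h₁).le
      (intervalIntegral.integral_nonneg hw fun r _ => singularWeight_nonneg h₀ r)

lemma kernelProfile_pos {w : ℝ} (hw₀ : 0 ≤ w) (hw : w < 1) : 0 < kernelProfile α w := by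
  refine mul_pos (inv_Gamma_pos h₁) ?_
  refine intervalIntegral.intervalIntegral_pos_of_pos_on
    (integrable_singularWeight h₀ h₁).intervalIntegrable (fun r hr => ?_) hw
  exact singularWeight_pos h₀ ⟨hw₀.trans_lt hr.1, hr.2⟩

lemma kernelProfile_le (w : ℝ) :
    kernelProfile α w ≤ 1 / Real.Gamma (1 - α) * ∫ r, singularWeight α r := by
  have hC := inv_Gamma_pos h₁
  rcases le_total 1 w with hw | hw
  · rw [kernelProfile_of_one_le hw]
    exact mul_nonneg hC.le (integral_nonneg (singularWeight_nonneg h₀))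
  · refine mul_le_mul_of_nonneg_left ?_ hC.le
    rw [intervalIntegral.integral_of_le hw]
    exact setIntegral_le_integral (integrable_singularWeight h₀ h₁)
      (Eventually.of_forall (singularWeight_nonneg h₀))

end Profile

/-- The first kernel, extended continuously to the plane. -/
def baseKernel (α p y : ℝ) : ℝ := p * kernelProfile α (y / p)

section Base

variable {α : ℝ}

/-- Strict inequalities are needed: at `μ = 0` the left side is `1`, the right side `0`. The
endpoints do not affect the integrals. -/
lemma weight_eq_of_mem {p μ : ℝ} (hμ : 0 < μ) (hp : μ < p) :
    (1 - p ^ (-(2 / α)) * μ ^ (2 / α)) ^ (-α) = singularWeight α (μ / p) := by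
  have hp0 : 0 < p := hμ.trans hp
  rw [singularWeight_of_mem ⟨by positivity, (div_lt_one hp0).2 hp⟩,
    Real.div_rpow hμ.le hp0.le, Real.rpow_neg hp0.le]
  congr 2
  field_simp

variable (h₀ : 0 < α) (h₁ : α < 1)
include h₀ h₁

lemma intervalIntegrable_singularWeight_div {p : ℝ} (a b : ℝ) (hp : 0 < p) :
    IntervalIntegrable (fun μ => singularWeight α (μ / p)) volume a b := by
  have := (integrable_singularWeight h₀ h₁).intervalIntegrable (a := a / p) (b := b / p)
  have := this.comp_mul_right (c := p⁻¹)
  simpa [div_eq_mul_inv, hp.ne'] using this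

lemma first_kernel_intervalIntegrable {p y : ℝ} (hy : 0 ≤ y) (hyp : y ≤ p) :
    IntervalIntegrable (fun μ : ℝ => (1 - p ^ (-(2 / α)) * μ ^ (2 / α)) ^ (-α)) volume y p := by
  rcases hyp.eq_or_lt with rfl | h
  · exact IntervalIntegrable.refl
  · refine (intervalIntegrable_congr_uIoo fun μ hμ => ?_).2
      (intervalIntegrable_singularWeight_div h₀ h₁ y p (hy.trans_lt h))
    rw [Set.uIoo_of_le hyp] at hμ
    exact weight_eq_of_mem (hy.trans_lt hμ.1) hμ.2

/-- The weight vanishes beyond `1`, so the upper limit may be raised past `p`. One limit `c` then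
serves all kernels in the later use of Fubini. -/
lemma integral_singularWeight_div {p y b : ℝ} (hp : 0 < p) (hb : p ≤ b) :
    1 / Real.Gamma (1 - α) * ∫ μ in y..b, singularWeight α (μ / p) = baseKernel α p y := by
  rw [intervalIntegral.integral_comp_div (singularWeight α) hp.ne', baseKernel, kernelProfile,
    ← intervalIntegral.integral_add_adjacent_intervals (b := 1)
      (integrable_singularWeight h₀ h₁).intervalIntegrable
      (integrable_singularWeight h₀ h₁).intervalIntegrable,
    intervalIntegral.integral_congr (a := 1) (g := fun _ => (0 : ℝ))]
  · simp; ring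
  · intro r hr
    rw [Set.uIcc_of_le ((one_le_div hp).2 hb)] at hr
    exact singularWeight_of_one_le hr.1

lemma M_zero_eq {p y : ℝ} (hy : 0 ≤ y) (hyp : y ≤ p) : M α 0 p y = baseKernel α p y := by
  rcases (hy.trans hyp).eq_or_lt with rfl | hp
  · obtain rfl : y = 0 := le_antisymm hyp hy
    simp [M, baseKernel]
  · rw [← integral_singularWeight_div h₀ h₁ hp le_rfl, M]
    congr 1
    exact intervalIntegral.integral_congr_Ioo_of_le hyp fun μ hμ =>
      weight_eq_of_mem (hy.trans_lt hμ.1) hμ.2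

lemma continuous_baseKernel : Continuous fun q : ℝ × ℝ => baseKernel α q.1 q.2 := by
  rw [continuous_iff_continuousAt]
  rintro ⟨p, y⟩
  rcases eq_or_ne p 0 with rfl | hp
  -- At `p = 0` the quotient `y / p` has no limit in general, but the profile is bounded by `B` and
  -- the factor `p` forces the limit `0`.
  · set B := 1 / Real.Gamma (1 - α) * ∫ r, singularWeight α r
    have h0 : baseKernel α 0 y = 0 := by simp [baseKernel]
    have hB : ∀ q : ℝ × ℝ, ‖baseKernel α q.1 q.2‖ ≤ |q.1| * B := fun q => by
      rw [baseKernel, norm_mul, Real.norm_eq_abs,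
        Real.norm_of_nonneg (kernelProfile_nonneg h₀ h₁ _)]
      exact mul_le_mul_of_nonneg_left (kernelProfile_le h₀ h₁ _) (abs_nonneg _)
    rw [ContinuousAt, h0]
    refine squeeze_zero_norm hB ?_
    have : Continuous fun q : ℝ × ℝ => |q.1| * B := by fun_prop
    simpa using this.tendsto (0, y)
  · have := (continuous_kernelProfile h₀ h₁).continuousAt (x := y / p)
    unfold baseKernel
    refine continuousAt_fst.mul (ContinuousAt.comp (g := kernelProfile α) this ?_)
    exact continuousAt_snd.div continuousAt_fst hp

lemma baseKernel_nonneg {p : ℝ} (hp : 0 ≤ p) (y : ℝ) : 0 ≤ baseKernel α p y :=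
  mul_nonneg hp (kernelProfile_nonneg h₀ h₁ _)

lemma baseKernel_pos {p y : ℝ} (hy : 0 ≤ y) (hyp : y < p) : 0 < baseKernel α p y :=
  have hp := hy.trans_lt hyp
  mul_pos hp (kernelProfile_pos h₀ h₁ (by positivity) ((div_lt_one hp).2 hyp))

-- This vanishing replaces the moving range `[y,p]` of the Volterra integrals by the fixed range
-- `[0,c]`, so that continuity and Fubini need no discussion of triangles.
omit h₀ h₁ in
lemma baseKernel_eq_zero {p y : ℝ} (hp : 0 ≤ p) (hyp : p ≤ y) : baseKernel α p y = 0 := by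
  rcases hp.eq_or_lt with rfl | hp
  · simp [baseKernel]
  · rw [baseKernel, kernelProfile_of_one_le ((one_le_div hp).2 hyp), mul_zero]

lemma baseKernel_le {c p : ℝ} (hp : 0 ≤ p) (hpc : p ≤ c) (y : ℝ) :
    baseKernel α p y ≤ c * (1 / Real.Gamma (1 - α) * ∫ r, singularWeight α r) :=
  mul_le_mul hpc (kernelProfile_le h₀ h₁ _) (kernelProfile_nonneg h₀ h₁ _) (hp.trans hpc)

end Base

/-! ### Iterated kernels. -/

/-- The iterated kernels on the square `[0,c]²`, extended continuously to the plane. -/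
def iteratedKernel (α c : ℝ) : ℕ → ℝ → ℝ → ℝ
  | 0, p, y => baseKernel α p y
  | n + 1, p, y => ∫ a in (0 : ℝ)..c, baseKernel α a y * iteratedKernel α c n p a

/-- The bound `c B` of the first kernel on `[0,c]²`. -/
def kernelBound (α c : ℝ) : ℝ := c * (1 / Real.Gamma (1 - α) * ∫ r, singularWeight α r)

lemma intervalIntegral_swap_of_continuous {F : ℝ → ℝ → ℝ} (hF : Continuous (Function.uncurry F))
    {a b a' b' : ℝ} (hab : a ≤ b) (hab' : a' ≤ b') :
    ∫ x in a..b, ∫ y in a'..b', F x y = ∫ y in a'..b', ∫ x in a..b, F x y := by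
  simp_rw [intervalIntegral.integral_of_le hab, intervalIntegral.integral_of_le hab']
  refine integral_integral_swap ?_
  rw [Measure.prod_restrict]
  exact (hF.continuousOn.integrableOn_compact (isCompact_Icc.prod isCompact_Icc)).mono_set
    (Set.prod_mono Set.Ioc_subset_Icc_self Set.Ioc_subset_Icc_self)

section Iterated

variable {α c : ℝ} (h₀ : 0 < α) (h₁ : α < 1)
include h₀ h₁

lemma continuous_iteratedKernel (n : ℕ) :
    Continuous fun q : ℝ × ℝ => iteratedKernel α c n q.1 q.2 := by
  induction n with
  | zero => exact continuous_baseKernel h₀ h₁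
  | succ n ih =>
    refine intervalIntegral.continuous_parametric_intervalIntegral_of_continuous' ?_ 0 c
    have hb := continuous_baseKernel h₀ h₁
    exact (hb.comp (f := fun z : (ℝ × ℝ) × ℝ => (z.2, z.1.2)) (by fun_prop)).mul
      (ih.comp (f := fun z : (ℝ × ℝ) × ℝ => (z.1.1, z.2)) (by fun_prop))

lemma continuous_kernel_mul (n : ℕ) (p y : ℝ) :
    Continuous fun a => baseKernel α a y * iteratedKernel α c n p a := by
  exact ((continuous_baseKernel h₀ h₁).comp (f := fun a : ℝ => (a, y)) (by fun_prop)).mul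
      ((continuous_iteratedKernel h₀ h₁ n).comp (f := fun a : ℝ => (p, a)) (by fun_prop))

omit h₀ h₁ in
lemma iteratedKernel_eq_zero (hc : 0 ≤ c) (n : ℕ) {p y : ℝ} (hp : 0 ≤ p) (hyp : p ≤ y) :
    iteratedKernel α c n p y = 0 := by
  induction n generalizing y with
  | zero => exact baseKernel_eq_zero hp hyp
  | succ n ih =>
    rw [iteratedKernel, intervalIntegral.integral_congr (g := fun _ => (0 : ℝ))]
    · simp
    · intro a ha
      rw [Set.uIcc_of_le hc] at ha
      rcases le_total a y with h | h
      · simp [baseKernel_eq_zero ha.1 h]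
      · simp [ih (hyp.trans h)]

lemma iteratedKernel_nonneg (hc : 0 ≤ c) (n : ℕ) {p : ℝ} (hp : 0 ≤ p) (y : ℝ) :
    0 ≤ iteratedKernel α c n p y := by
  induction n generalizing y with
  | zero => exact baseKernel_nonneg h₀ h₁ hp y
  | succ n ih =>
    exact intervalIntegral.integral_nonneg hc fun a ha =>
      mul_nonneg (baseKernel_nonneg h₀ h₁ ha.1 y) (ih a)

lemma iteratedKernel_succ (n : ℕ) {p y : ℝ} (hy : 0 ≤ y) (hyp : y ≤ p) (hpc : p ≤ c) :
    iteratedKernel α c (n + 1) p y =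
      ∫ a in y..p, baseKernel α a y * iteratedKernel α c n p a := by
  have hi (a b : ℝ) := (continuous_kernel_mul (c := c) h₀ h₁ n p y).intervalIntegrable
    (μ := volume) a b
  have h₁' : ∫ a in (0 : ℝ)..y, baseKernel α a y * iteratedKernel α c n p a = 0 := by
    rw [intervalIntegral.integral_congr (g := fun _ => (0 : ℝ))]
    · simp
    · intro a ha
      rw [Set.uIcc_of_le hy] at ha
      simp [baseKernel_eq_zero ha.1 ha.2]
  have h₂' : ∫ a in p..c, baseKernel α a y * iteratedKernel α c n p a = 0 := by
    rw [intervalIntegral.integral_congr (g := fun _ => (0 : ℝ))]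
    · simp
    · intro a ha
      rw [Set.uIcc_of_le hpc] at ha
      simp [iteratedKernel_eq_zero (hy.trans (hyp.trans hpc)) n (hy.trans hyp) ha.1]
  rw [iteratedKernel, ← intervalIntegral.integral_add_adjacent_intervals (hi 0 y) (hi y c), h₁',
    ← intervalIntegral.integral_add_adjacent_intervals (hi y p) (hi p c), h₂']
  ring

lemma M_eq_iteratedKernel (n : ℕ) {p y : ℝ} (hy : 0 ≤ y) (hyp : y ≤ p) (hpc : p ≤ c) :
    M α n p y = iteratedKernel α c n p y := by
  induction n generalizing y with
  | zero => exact M_zero_eq h₀ h₁ hy hyp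
  | succ n ih =>
    rw [iteratedKernel_succ h₀ h₁ n hy hyp hpc, M]
    refine intervalIntegral.integral_congr fun a ha => ?_
    rw [Set.uIcc_of_le hyp] at ha
    rw [M_zero_eq h₀ h₁ hy ha.1, ih (hy.trans ha.1) ha.2]

lemma kernelBound_nonneg (hc : 0 ≤ c) : 0 ≤ kernelBound α c :=
  mul_nonneg hc (mul_nonneg (inv_Gamma_pos h₁).le (integral_nonneg (singularWeight_nonneg h₀)))

/-- The usual Volterra estimate: each iteration costs a factor `kernelBound α c` and one more
integration of a power of `p - a`, which produces the factorial. -/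
lemma iteratedKernel_le_of_le (n : ℕ) {p y : ℝ} (hy : 0 ≤ y) (hyp : y ≤ p) (hpc : p ≤ c) :
    iteratedKernel α c n p y ≤ kernelBound α c ^ (n + 1) * ((p - y) ^ n / n.factorial) := by
  have hc : 0 ≤ c := hy.trans (hyp.trans hpc)
  have hD := kernelBound_nonneg (α := α) h₀ h₁ hc
  induction n generalizing y with
  | zero => simpa [kernelBound, iteratedKernel] using baseKernel_le h₀ h₁ (hy.trans hyp) hpc y
  | succ n ih =>
    rw [iteratedKernel_succ h₀ h₁ n hy hyp hpc]
    have hle : ∫ a in y..p, baseKernel α a y * iteratedKernel α c n p a ≤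
        ∫ a in y..p, kernelBound α c * (kernelBound α c ^ (n + 1) *
          ((p - a) ^ n / n.factorial)) := by
      refine intervalIntegral.integral_mono_on hyp
        ((continuous_kernel_mul h₀ h₁ n p y).intervalIntegrable _ _)
        ((by fun_prop : Continuous _).intervalIntegrable _ _) fun a ha => ?_
      exact mul_le_mul (baseKernel_le h₀ h₁ (hy.trans ha.1) (ha.2.trans hpc) y)
        (ih (hy.trans ha.1) ha.2) (iteratedKernel_nonneg h₀ h₁ hc n (hy.trans hyp) a) hD
    refine hle.trans_eq ?_
    have hint : ∫ a in y..p, (p - a) ^ n = (p - y) ^ (n + 1) / (n + 1) := by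
      rw [intervalIntegral.integral_comp_sub_left (fun x => x ^ n) p, integral_pow]
      simp
    simp_rw [intervalIntegral.integral_const_mul, intervalIntegral.integral_div]
    rw [hint, Nat.factorial_succ]
    push_cast
    field_simp
    ring

lemma norm_iteratedKernel_le (n : ℕ) {q : ℝ × ℝ} (hq : q ∈ Set.Icc 0 c ×ˢ Set.Icc 0 c) :
    ‖iteratedKernel α c n q.1 q.2‖ ≤ kernelBound α c * ((kernelBound α c * c) ^ n / n.factorial) := by
  obtain ⟨⟨hp, hpc⟩, hy, hyc⟩ := hq
  have hc : 0 ≤ c := hp.trans hpc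
  have hD := kernelBound_nonneg (α := α) h₀ h₁ hc
  rw [Real.norm_of_nonneg (iteratedKernel_nonneg h₀ h₁ hc n hp _)]
  rcases le_total q.1 q.2 with h | h
  · rw [iteratedKernel_eq_zero hc n hp h]
    positivity
  · refine (iteratedKernel_le_of_le h₀ h₁ n hy h hpc).trans ?_
    rw [mul_pow, pow_succ', mul_assoc, mul_div_assoc]
    gcongr
    linarith

/-- Composition of kernels is associative, so the additional first kernel may be attached at the
other end. This is the source of the second resolvent equation. -/
lemma iteratedKernel_succ' (hc : 0 ≤ c) (n : ℕ) (p y : ℝ) :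
    iteratedKernel α c (n + 1) p y =
      ∫ a in (0 : ℝ)..c, iteratedKernel α c n a y * baseKernel α p a := by
  have hb := continuous_baseKernel h₀ h₁
  induction n generalizing p y with
  | zero => simp only [iteratedKernel]
  | succ n ih =>
    have hk := continuous_iteratedKernel (c := c) h₀ h₁ n
    have hs (a : ℝ) : iteratedKernel α c (n + 1) a y =
      ∫ b in (0 : ℝ)..c, baseKernel α b y * iteratedKernel α c n a b := rfl
    simp_rw [hs]
    rw [iteratedKernel]
    simp_rw [ih, ← intervalIntegral.integral_mul_const, ← intervalIntegral.integral_const_mul]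
    rw [intervalIntegral_swap_of_continuous _ hc hc]
    · simp_rw [mul_assoc]
    · exact (hb.comp (f := fun z : ℝ × ℝ => (z.1, y)) (by fun_prop)).mul
        ((hk.comp (f := fun z : ℝ × ℝ => (z.2, z.1)) (by fun_prop)).mul
          (hb.comp (f := fun z : ℝ × ℝ => (p, z.2)) (by fun_prop)))

end Iterated

/-! ### The resolvent and its two integral equations. -/

/-- The resolvent kernel on the square `[0,c]²`. -/
def resolventKernel (α c p y : ℝ) : ℝ := ∑' n, iteratedKernel α c n p y

section Resolvent

variable {α c : ℝ}

lemma N_eq_resolventKernel (h₀ : 0 < α) (h₁ : α < 1) {p y : ℝ} (hy : 0 ≤ y) (hyp : y ≤ p)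
    (hpc : p ≤ c) : N α p y = resolventKernel α c p y :=
  tsum_congr fun n => M_eq_iteratedKernel h₀ h₁ n hy hyp hpc

lemma summable_kernelBound :
    Summable fun n : ℕ => kernelBound α c * ((kernelBound α c * c) ^ n / n.factorial) :=
  (Real.summable_pow_div_factorial _).mul_left _

variable (h₀ : 0 < α) (h₁ : α < 1)
include h₀ h₁

lemma summable_iteratedKernel {q : ℝ × ℝ} (hq : q ∈ Set.Icc 0 c ×ˢ Set.Icc 0 c) :
    Summable fun n => iteratedKernel α c n q.1 q.2 :=
  Summable.of_norm_bounded summable_kernelBound fun n => norm_iteratedKernel_le h₀ h₁ n hq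

lemma continuousOn_resolventKernel :
    ContinuousOn (fun q : ℝ × ℝ => resolventKernel α c q.1 q.2)
      (Set.Icc 0 c ×ˢ Set.Icc 0 c) :=
  continuousOn_tsum (fun n => (continuous_iteratedKernel h₀ h₁ n).continuousOn)
    summable_kernelBound fun n _ hq => norm_iteratedKernel_le h₀ h₁ n hq

omit h₀ h₁ in
lemma resolventKernel_eq_zero (hc : 0 ≤ c) {p y : ℝ} (hp : 0 ≤ p) (hyp : p ≤ y) :
    resolventKernel α c p y = 0 := by
  simp [resolventKernel, iteratedKernel_eq_zero hc _ hp hyp]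

lemma resolventKernel_nonneg (hc : 0 ≤ c) {p : ℝ} (hp : 0 ≤ p) (y : ℝ) :
    0 ≤ resolventKernel α c p y :=
  tsum_nonneg fun n => iteratedKernel_nonneg h₀ h₁ hc n hp y

/-- Summation of the recursion: the term `n = 0` is split off, and the factorial bound allows the
sum to pass through the integral. -/
lemma resolventKernel_eq_add {p y : ℝ} (hp : p ∈ Set.Icc 0 c) (hy : y ∈ Set.Icc 0 c) :
    resolventKernel α c p y = baseKernel α p y +
      ∫ a in (0 : ℝ)..c, baseKernel α a y * resolventKernel α c p a := by
  have hc : 0 ≤ c := hp.1.trans hp.2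
  have hs := summable_iteratedKernel h₀ h₁ (q := (p, y)) ⟨hp, hy⟩
  have hd : ∀ a ∈ Set.uIoc 0 c, a ∈ Set.Icc 0 c := fun a ha => by
    rw [Set.uIoc_of_le hc] at ha; exact Set.Ioc_subset_Icc_self ha
  have := intervalIntegral.hasSum_integral_of_dominated_convergence (μ := volume) (a := 0) (b := c)
    (F := fun n a => baseKernel α a y * iteratedKernel α c n p a)
    (f := fun a => baseKernel α a y * resolventKernel α c p a)
    (bound := fun n _ => kernelBound α c *
      (kernelBound α c * ((kernelBound α c * c) ^ n / n.factorial)))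
    (fun n => (continuous_kernel_mul h₀ h₁ n p y).aestronglyMeasurable)
    (fun n => Eventually.of_forall fun a ha => by
      rw [norm_mul, Real.norm_of_nonneg (baseKernel_nonneg h₀ h₁ (hd a ha).1 y)]
      exact mul_le_mul (baseKernel_le h₀ h₁ (hd a ha).1 (hd a ha).2 y)
        (norm_iteratedKernel_le h₀ h₁ n (q := (p, a)) ⟨hp, hd a ha⟩) (norm_nonneg _)
        (kernelBound_nonneg h₀ h₁ hc))
    (Eventually.of_forall fun a _ => summable_kernelBound.mul_left _)
    intervalIntegrable_const
    (Eventually.of_forall fun a ha =>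
      (summable_iteratedKernel h₀ h₁ (q := (p, a)) ⟨hp, hd a ha⟩).hasSum.mul_left _)
  rw [← this.tsum_eq, resolventKernel, hs.tsum_eq_zero_add]
  rfl

/-- The same summation for the recursion with the factors in the other order,
`iteratedKernel_succ'`. -/
lemma resolventKernel_eq_add' {p y : ℝ} (hp : p ∈ Set.Icc 0 c) (hy : y ∈ Set.Icc 0 c) :
    resolventKernel α c p y = baseKernel α p y +
      ∫ a in (0 : ℝ)..c, resolventKernel α c a y * baseKernel α p a := by
  have hc : 0 ≤ c := hp.1.trans hp.2
  have hs := summable_iteratedKernel h₀ h₁ (q := (p, y)) ⟨hp, hy⟩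
  have hd : ∀ a ∈ Set.uIoc 0 c, a ∈ Set.Icc 0 c := fun a ha => by
    rw [Set.uIoc_of_le hc] at ha; exact Set.Ioc_subset_Icc_self ha
  have hb := continuous_baseKernel h₀ h₁
  have := intervalIntegral.hasSum_integral_of_dominated_convergence (μ := volume) (a := 0) (b := c)
    (F := fun n a => iteratedKernel α c n a y * baseKernel α p a)
    (f := fun a => resolventKernel α c a y * baseKernel α p a)
    (bound := fun n _ => (kernelBound α c * ((kernelBound α c * c) ^ n / n.factorial)) *
      kernelBound α c)
    (fun n => (((continuous_iteratedKernel h₀ h₁ n).comp (f := fun a : ℝ => (a, y))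
      (by fun_prop)).mul
      (hb.comp (f := fun a : ℝ => (p, a)) (by fun_prop))).aestronglyMeasurable)
    (fun n => Eventually.of_forall fun a ha => by
      rw [norm_mul, Real.norm_of_nonneg (baseKernel_nonneg h₀ h₁ hp.1 a)]
      exact mul_le_mul (norm_iteratedKernel_le h₀ h₁ n (q := (a, y)) ⟨hd a ha, hy⟩)
        (baseKernel_le h₀ h₁ hp.1 hp.2 a) (baseKernel_nonneg h₀ h₁ hp.1 a)
        ((norm_nonneg _).trans (norm_iteratedKernel_le h₀ h₁ n (q := (a, y)) ⟨hd a ha, hy⟩)))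
    (Eventually.of_forall fun a _ => summable_kernelBound.mul_right _)
    intervalIntegrable_const
    (Eventually.of_forall fun a ha =>
      (summable_iteratedKernel h₀ h₁ (q := (a, y)) ⟨hd a ha, hy⟩).hasSum.mul_right _)
  rw [← this.tsum_eq, resolventKernel, hs.tsum_eq_zero_add]
  simp_rw [iteratedKernel_succ' h₀ h₁ hc]
  rfl

end Resolvent

/-! ### The flux profile, convergence of the formulas, and the reduction of `∫ H G`. -/

/-- The resolvent kernel, extended continuously from `[0,c]²` to the plane. -/
def resolventExt (α c p y : ℝ) : ℝ :=
  resolventKernel α c (max 0 (min c p)) (max 0 (min c y))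

lemma clamp_mem {c : ℝ} (hc : 0 ≤ c) (y : ℝ) : max 0 (min c y) ∈ Set.Icc 0 c :=
  ⟨le_max_left _ _, max_le hc (min_le_left _ _)⟩

lemma clamp_of_mem {c y : ℝ} (hy : y ∈ Set.Icc 0 c) : max 0 (min c y) = y := by
  rw [min_eq_right hy.2, max_eq_right hy.1]

/-- The self-similar flux `-f'`, where `u(x,t) = f(x t^(-α/2))`. -/
def fluxProfile (α c y : ℝ) : ℝ := resolventExt α c c y

section Ext

variable {α c : ℝ} (h₀ : 0 < α) (h₁ : α < 1)

lemma resolventExt_of_mem {p y : ℝ} (hp : p ∈ Set.Icc 0 c) (hy : y ∈ Set.Icc 0 c) :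
    resolventExt α c p y = resolventKernel α c p y := by
  rw [resolventExt, clamp_of_mem hp, clamp_of_mem hy]

include h₀ h₁

lemma continuous_resolventExt (hc : 0 ≤ c) :
    Continuous fun q : ℝ × ℝ => resolventExt α c q.1 q.2 :=
  (continuousOn_resolventKernel h₀ h₁).comp_continuous
    (f := fun q : ℝ × ℝ => (max 0 (min c q.1), max 0 (min c q.2))) (by fun_prop)
    fun q => ⟨clamp_mem hc q.1, clamp_mem hc q.2⟩

lemma N_eq_resolventExt {p y : ℝ} (hy : 0 ≤ y) (hyp : y ≤ p) (hpc : p ≤ c) :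
    N α p y = resolventExt α c p y := by
  rw [N_eq_resolventKernel h₀ h₁ hy hyp hpc,
    resolventExt_of_mem ⟨hy.trans hyp, hpc⟩ ⟨hy, hyp.trans hpc⟩]

omit h₀ h₁ in
lemma resolventExt_eq_zero (hc : 0 ≤ c) {p y : ℝ} (hyp : p ≤ y) : resolventExt α c p y = 0 :=
  resolventKernel_eq_zero hc (le_max_left _ _)
    (max_le_max le_rfl (min_le_min le_rfl hyp))

lemma continuous_fluxProfile (hc : 0 ≤ c) : Continuous (fluxProfile α c) :=
  (continuous_resolventExt h₀ h₁ hc).comp (f := fun y : ℝ => (c, y)) (by fun_prop)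

omit h₀ h₁ in
lemma fluxProfile_eq_zero (hc : 0 ≤ c) {y : ℝ} (hy : c ≤ y) : fluxProfile α c y = 0 :=
  resolventExt_eq_zero hc hy

lemma fluxProfile_nonneg (hc : 0 ≤ c) (y : ℝ) : 0 ≤ fluxProfile α c y :=
  resolventKernel_nonneg h₀ h₁ hc (le_max_left _ _) _

lemma exists_fluxProfile_le (hc : 0 ≤ c) : ∃ B, ∀ y, ‖fluxProfile α c y‖ ≤ B := by
  obtain ⟨B, hB⟩ := isCompact_Icc.exists_bound_of_continuousOn
    (continuous_fluxProfile h₀ h₁ hc).continuousOn (s := Set.Icc 0 c)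
  refine ⟨B, fun y => ?_⟩
  have := hB _ (clamp_mem hc y)
  simpa only [fluxProfile, resolventExt, clamp_of_mem (clamp_mem hc y)] using this

lemma fluxProfile_eq_add {y : ℝ} (hy : y ∈ Set.Icc 0 c) :
    fluxProfile α c y = baseKernel α c y +
      ∫ a in (0 : ℝ)..c, baseKernel α a y * fluxProfile α c a := by
  have hc : c ∈ Set.Icc 0 c := ⟨hy.1.trans hy.2, le_rfl⟩
  rw [fluxProfile, resolventExt_of_mem hc hy, resolventKernel_eq_add h₀ h₁ hc hy]
  congr 1
  refine intervalIntegral.integral_congr fun a ha => ?_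
  rw [Set.uIcc_of_le hc.1] at ha
  rw [fluxProfile, resolventExt_of_mem hc ha]

lemma fluxProfile_pos {y : ℝ} (hy : 0 ≤ y) (hyc : y < c) : 0 < fluxProfile α c y := by
  have hc := hy.trans hyc.le
  rw [fluxProfile_eq_add h₀ h₁ ⟨hy, hyc.le⟩]
  refine add_pos_of_pos_of_nonneg (baseKernel_pos h₀ h₁ hy hyc) ?_
  exact intervalIntegral.integral_nonneg hc fun a ha =>
    mul_nonneg (baseKernel_nonneg h₀ h₁ ha.1 y) (fluxProfile_nonneg h₀ h₁ hc a)

/-- The extended resolvent vanishes for `y ≥ p`, so the upper limit can be made independent of `p`,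
ready for Fubini. -/
lemma H_eq {p z : ℝ} (hz : 0 ≤ z) (hzp : z ≤ p) (hpc : p ≤ c) :
    H α p z = 1 + ∫ y in z..c, resolventExt α c p y := by
  have hc := hz.trans (hzp.trans hpc)
  have hcont : Continuous fun y => resolventExt α c p y :=
    (continuous_resolventExt h₀ h₁ hc).comp (f := fun y : ℝ => (p, y)) (by fun_prop)
  rw [H, ← intervalIntegral.integral_add_adjacent_intervals (b := p)
    (hcont.intervalIntegrable z p) (hcont.intervalIntegrable p c),
    intervalIntegral.integral_congr (a := p) (b := c) (g := fun _ => (0 : ℝ))]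
  · simp only [intervalIntegral.integral_zero, add_zero]
    congr 1
    refine intervalIntegral.integral_congr fun y hy => ?_
    rw [Set.uIcc_of_le hzp] at hy
    exact N_eq_resolventExt h₀ h₁ (hz.trans hy.1) hy.2 hpc
  · intro y hy
    rw [Set.uIcc_of_le hpc] at hy
    exact resolventExt_eq_zero hc hy.1

lemma continuous_integral_resolventExt (hc : 0 ≤ c) (z : ℝ) :
    Continuous fun p => ∫ y in z..c, resolventExt α c p y :=
  intervalIntegral.continuous_parametric_intervalIntegral_of_continuous'
    (continuous_resolventExt h₀ h₁ hc) z c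

lemma H_mul_G_eq {p z : ℝ} (hz : 0 ≤ z) (hzp : z ≤ p) (hpc : p ≤ c) :
    H α p z * G α c p = baseKernel α c p +
      (∫ y in z..c, resolventExt α c p y) * baseKernel α c p := by
  have hG : G α c p = baseKernel α c p := by
    rw [← M_zero_eq h₀ h₁ (hz.trans hzp) hpc, M, G]
  rw [H_eq h₀ h₁ hz hzp hpc, hG]
  ring

lemma continuous_baseKernel_right (p : ℝ) : Continuous fun y => baseKernel α p y :=
  (continuous_baseKernel h₀ h₁).comp (f := fun y : ℝ => (p, y)) (by fun_prop)

lemma formulasConverge (hc : 0 ≤ c) : FormulasConverge α c where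
  first_kernel p y hy hyp := first_kernel_intervalIntegrable h₀ h₁ hy hyp
  kernels n p y hy hyp := by
    -- `M` does not depend on the size of the square, so the square `[0,p]²` may be used for each
    -- `p`.
    refine ((continuous_kernel_mul (c := p) h₀ h₁ n p y).intervalIntegrable y p).congr
      fun a ha => ?_
    rw [Set.uIoc_of_le hyp] at ha
    rw [M_zero_eq h₀ h₁ hy ha.1.le, M_eq_iteratedKernel h₀ h₁ n (hy.trans ha.1.le) ha.2 le_rfl]
  series p y hy hyp :=
    (summable_iteratedKernel h₀ h₁ (q := (p, y)) (c := p)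
      ⟨⟨hy.trans hyp, le_rfl⟩, hy, hyp⟩).congr
      fun n => (M_eq_iteratedKernel h₀ h₁ n hy hyp le_rfl).symm
  resolvent p x hx hxp := by
    have hcont := (continuous_resolventExt (c := p) h₀ h₁ (hx.trans hxp)).comp
      (f := fun y : ℝ => (p, y)) (by fun_prop)
    refine (hcont.intervalIntegrable x p).congr fun y hy => ?_
    rw [Set.uIoc_of_le hxp] at hy
    exact (N_eq_resolventExt h₀ h₁ (hx.trans hy.1.le) hy.2 le_rfl).symm
  profile x hx hxc := by
    have hb := continuous_baseKernel_right h₀ h₁ c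
    have hr := continuous_integral_resolventExt h₀ h₁ hc x
    refine ((hb.add (hr.mul hb)).intervalIntegrable x c).congr fun p hp => ?_
    rw [Set.uIoc_of_le hxc] at hp
    exact (H_mul_G_eq h₀ h₁ hx hp.1.le hp.2).symm

/-- Since `G` is `M_1(c,·)`, exchanging the integrals over `p` and `y` leaves `M_1(c,y) + ∫ N(p,y)
M_1(c,p) dp`, which is `N(c,y)` by the second resolvent equation. -/
lemma integral_H_mul_G {z : ℝ} (hz : 0 ≤ z) (hzc : z ≤ c) :
    ∫ p in z..c, H α p z * G α c p = ∫ y in z..c, fluxProfile α c y := by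
  have hc := hz.trans hzc
  have hb := continuous_baseKernel_right h₀ h₁ c
  have hr := continuous_integral_resolventExt h₀ h₁ hc z
  have he := continuous_resolventExt h₀ h₁ hc
  have hF : Continuous (Function.uncurry fun p y => resolventExt α c p y * baseKernel α c p) :=
    he.mul (hb.comp continuous_fst)
  have hI : Continuous fun y => ∫ p in z..c, resolventExt α c p y * baseKernel α c p :=
    intervalIntegral.continuous_parametric_intervalIntegral_of_continuous'
      (f := fun y p => resolventExt α c p y * baseKernel α c p) (hF.comp continuous_swap) z c
  calc ∫ p in z..c, H α p z * G α c p
      = ∫ p in z..c, (baseKernel α c p +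
          (∫ y in z..c, resolventExt α c p y) * baseKernel α c p) := by
        refine intervalIntegral.integral_congr fun p hp => ?_
        rw [Set.uIcc_of_le hzc] at hp
        exact H_mul_G_eq h₀ h₁ hz hp.1 hp.2
    _ = (∫ p in z..c, baseKernel α c p) +
          ∫ p in z..c, ∫ y in z..c, resolventExt α c p y * baseKernel α c p := by
        simp_rw [intervalIntegral.integral_mul_const]
        exact intervalIntegral.integral_add (hb.intervalIntegrable _ _)
          ((hr.mul hb).intervalIntegrable _ _)
    _ = ∫ y in z..c, (baseKernel α c y +
          ∫ p in z..c, resolventExt α c p y * baseKernel α c p) := by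
        rw [intervalIntegral_swap_of_continuous hF hzc hzc]
        exact (intervalIntegral.integral_add (hb.intervalIntegrable _ _)
          (hI.intervalIntegrable _ _)).symm
    _ = ∫ y in z..c, fluxProfile α c y := by
        refine intervalIntegral.integral_congr fun y hy => ?_
        rw [Set.uIcc_of_le hzc] at hy
        have hy' : y ∈ Set.Icc 0 c := ⟨hz.trans hy.1, hy.2⟩
        have hi (a b : ℝ) : IntervalIntegrable
            (fun p => resolventExt α c p y * baseKernel α c p) volume a b :=
          (hF.comp (f := fun p : ℝ => (p, y)) (by fun_prop)).intervalIntegrable a b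
        -- The resolvent equation integrates over `[0,c]`; the part over `[0,z]` is zero because
        -- there `p ≤ z ≤ y`.
        rw [fluxProfile, resolventExt_of_mem ⟨hc, le_rfl⟩ hy',
          resolventKernel_eq_add' h₀ h₁ ⟨hc, le_rfl⟩ hy',
          ← intervalIntegral.integral_congr (a := 0) (b := c)
            (f := fun p => resolventExt α c p y * baseKernel α c p),
          ← intervalIntegral.integral_add_adjacent_intervals (hi 0 z) (hi z c),
          intervalIntegral.integral_congr (a := 0) (b := z) (g := fun _ => (0 : ℝ))]
        · simp
        · intro p hp
          rw [Set.uIcc_of_le hz] at hp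
          simp [resolventExt_eq_zero hc (hp.2.trans hy.1)]
        · intro p hp
          rw [Set.uIcc_of_le hc] at hp
          simp only [resolventExt_of_mem hp hy']

end Ext

/-! ### The derivative of the flux profile. -/

/-- The regular part `∫_0^c φ(z/μ) g(μ) dμ` of `-Γ(1-α) g'`. -/
def memoryTerm (α c z : ℝ) : ℝ := ∫ μ in (0 : ℝ)..c, singularWeight α (z / μ) * fluxProfile α c μ

section Memory

variable {α c : ℝ} (h₀ : 0 < α) (h₁ : α < 1)
include h₀ h₁

/-- For `w > 1`, `1 - 1/w = (w - 1)/w`, so the weight is at most `w^α (w-1)^(-α)`, and `w ≤ W`. -/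
lemma intervalIntegrable_singularWeight_inv {W : ℝ} (hW : 1 ≤ W) :
    IntervalIntegrable (fun w => singularWeight α (1 / w)) volume 0 W := by
  have hm : Measurable fun w : ℝ => singularWeight α (1 / w) :=
    measurable_singularWeight.comp (by fun_prop)
  refine IntervalIntegrable.trans (b := 1) ?_ ?_
  · refine (intervalIntegrable_const (c := (0 : ℝ))).congr fun w hw => ?_
    rw [Set.uIoc_of_le zero_le_one] at hw
    exact (singularWeight_of_one_le ((one_le_div hw.1).2 hw.2)).symm
  · have hi : IntervalIntegrable (fun w : ℝ => W ^ α * (w - 1) ^ (-α)) volume 1 W := by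
      have := (intervalIntegral.intervalIntegrable_rpow' (a := 1 - 1) (b := W - 1)
        (by linarith : -1 < -α)).comp_sub_right 1
      simp only [sub_add_cancel] at this
      exact this.const_mul _
    refine hi.mono_fun' hm.aestronglyMeasurable ?_
    filter_upwards [ae_restrict_mem measurableSet_uIoc] with w hw
    rw [Set.uIoc_of_le hW] at hw
    have hw0 : 0 < w := by linarith [hw.1]
    rw [Real.norm_of_nonneg (singularWeight_nonneg h₀ _)]
    refine (singularWeight_le h₀ h₁ ((div_le_one hw0).2 hw.1.le)).trans ?_
    have : 1 - 1 / w = (w - 1) / w := by field_simp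
    rw [this, Real.div_rpow (by linarith [hw.1]) hw0.le, Real.rpow_neg hw0.le, div_inv_eq_mul,
      mul_comm]
    have := hw.1
    have := hw.2
    gcongr

/-- The substitution `μ = z w` moves the dependence on `z` from the singular weight to the
continuous profile. The limit `c / z` may be replaced by a fixed `W` because the profile vanishes
beyond `c`. -/
lemma memoryTerm_eq (hc : 0 ≤ c) {z W : ℝ} (hz : 0 < z) (hW : 1 ≤ W) (hcW : c / z ≤ W) :
    memoryTerm α c z =
      z * ∫ w in (0 : ℝ)..W, singularWeight α (1 / w) * fluxProfile α c (z * w) := by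
  set f : ℝ → ℝ := fun w => singularWeight α (1 / w) * fluxProfile α c (z * w) with hf
  have hi : IntervalIntegrable f volume 0 W :=
    (intervalIntegrable_singularWeight_inv h₀ h₁ hW).mul_continuousOn
      ((continuous_fluxProfile h₀ h₁ hc).comp (by fun_prop)).continuousOn
  have h0 : 0 ≤ c / z := by positivity
  have hmem : c / z ∈ Set.uIcc 0 W := by
    rw [Set.uIcc_of_le (by linarith)]; exact ⟨h0, hcW⟩
  have hsub := intervalIntegral.integral_comp_div (a := 0) (b := c) f hz.ne'
  rw [memoryTerm]
  have heq : ∀ μ, singularWeight α (z / μ) * fluxProfile α c μ = f (μ / z) := fun μ => by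
    simp only [hf]
    rw [one_div_div, mul_div_cancel₀ _ hz.ne']
  simp_rw [heq]
  rw [hsub, zero_div, smul_eq_mul, ← intervalIntegral.integral_add_adjacent_intervals (b := c / z)
    (a := 0) (c := W) (hi.mono_set (Set.uIcc_subset_uIcc_left hmem))
    (hi.mono_set (Set.uIcc_subset_uIcc_right hmem)),
    intervalIntegral.integral_congr (a := c / z) (g := fun _ => (0 : ℝ))]
  · simp
  · intro w hw
    rw [Set.uIcc_of_le hcW, Set.mem_Icc, div_le_iff₀' hz] at hw
    simp [hf, fluxProfile_eq_zero hc hw.1]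

lemma continuousAt_memoryTerm (hc : 0 ≤ c) {z : ℝ} (hz : 0 < z) :
    ContinuousAt (memoryTerm α c) z := by
  obtain ⟨B, hB⟩ := exists_fluxProfile_le (c := c) h₀ h₁ hc
  -- `c / x ≤ 2 c / z` for all `x > z / 2`, so a single `W` works near `z`.
  set W := 1 + 2 * c / z
  have hW : 1 ≤ W := by
    have : 0 ≤ 2 * c / z := by positivity
    simp only [W]; linarith
  have hg := continuous_fluxProfile (c := c) h₀ h₁ hc
  have hi := intervalIntegrable_singularWeight_inv h₀ h₁ hW
  have hm : Measurable fun w : ℝ => singularWeight α (1 / w) :=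
    measurable_singularWeight.comp (by fun_prop)
  have hcont : Continuous fun x : ℝ => x *
      ∫ w in (0 : ℝ)..W, singularWeight α (1 / w) * fluxProfile α c (x * w) := by
    refine continuous_id.mul ?_
    refine intervalIntegral.continuous_of_dominated_interval
      (bound := fun w => singularWeight α (1 / w) * B) (fun x => ?_) (fun x => ?_)
      (hi.mul_const B) ?_
    · exact hm.aestronglyMeasurable.mul
        (hg.comp (f := fun w => x * w) (by fun_prop)).aestronglyMeasurable
    · refine Eventually.of_forall fun w _ => ?_
      rw [norm_mul, Real.norm_of_nonneg (singularWeight_nonneg h₀ _)]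
      exact mul_le_mul_of_nonneg_left (hB _) (singularWeight_nonneg h₀ _)
    · exact Eventually.of_forall fun w _ =>
        continuous_const.mul (hg.comp (by fun_prop))
  refine hcont.continuousAt.congr ?_
  filter_upwards [lt_mem_nhds (half_lt_self hz)] with x hx
  have hx0 : 0 < x := by linarith
  refine (memoryTerm_eq h₀ h₁ hc hx0 hW ?_).symm
  have : c / x ≤ 2 * c / z := by
    rw [div_le_div_iff₀ hx0 hz]
    nlinarith
  simp only [W]; linarith

/-- Fubini: for `0 < a ≤ c`, `M_1(a,y)` is `1/Γ(1-α)` times the integral of `φ(z/a)` over `z` in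
`[y,c]`. This exhibits the integral term of the equation for `g` as a primitive. -/
lemma integral_baseKernel_mul_fluxProfile (hc : 0 ≤ c) {y : ℝ} (hyc : y ≤ c) :
    ∫ a in (0 : ℝ)..c, baseKernel α a y * fluxProfile α c a =
      1 / Real.Gamma (1 - α) * ∫ z in y..c, memoryTerm α c z := by
  have hC := inv_Gamma_pos h₁
  have hg := continuous_fluxProfile (c := c) h₀ h₁ hc
  set C := 1 / Real.Gamma (1 - α) with hCdef
  have hint : ∀ a ∈ Set.Ioc 0 c, ∫ z in Set.Ioc y c, singularWeight α (z / a) =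
      C⁻¹ * baseKernel α a y := fun a ha => by
    rw [← integral_singularWeight_div h₀ h₁ ha.1 ha.2, ← hCdef, inv_mul_cancel_left₀ hC.ne',
      intervalIntegral.integral_of_le hyc]
  have hF : Integrable (Function.uncurry fun a z => singularWeight α (z / a) * fluxProfile α c a)
      ((volume.restrict (Set.Ioc 0 c)).prod (volume.restrict (Set.Ioc y c))) := by
    have hmeas : Measurable (Function.uncurry fun a z : ℝ =>
        singularWeight α (z / a) * fluxProfile α c a) :=
      (measurable_singularWeight.comp (measurable_snd.div measurable_fst)).mul
        (hg.measurable.comp measurable_fst)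
    refine (integrable_prod_iff hmeas.aestronglyMeasurable).2 ⟨?_, ?_⟩
    · filter_upwards [ae_restrict_mem measurableSet_Ioc] with a ha
      exact ((intervalIntegrable_iff_integrableOn_Ioc_of_le hyc).1
        (intervalIntegrable_singularWeight_div h₀ h₁ y c ha.1)).mul_const (fluxProfile α c a)
    · have hb : Continuous fun a => C⁻¹ * baseKernel α a y * fluxProfile α c a :=
        (continuous_const.mul ((continuous_baseKernel h₀ h₁).comp (f := fun a : ℝ => (a, y))
          (by fun_prop))).mul hg
      have hb' := (intervalIntegrable_iff_integrableOn_Ioc_of_le hc).1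
        (hb.intervalIntegrable (μ := volume) 0 c)
      refine hb'.congr ?_
      filter_upwards [ae_restrict_mem measurableSet_Ioc] with a ha
      rw [← hint a ha, ← integral_mul_const]
      refine integral_congr_ae (Eventually.of_forall fun z => ?_)
      exact (Real.norm_of_nonneg (mul_nonneg (singularWeight_nonneg h₀ _)
        (fluxProfile_nonneg h₀ h₁ hc a))).symm
  simp_rw [memoryTerm, intervalIntegral.integral_of_le hc, intervalIntegral.integral_of_le hyc]
  rw [← integral_integral_swap hF, ← integral_const_mul]
  refine setIntegral_congr_fun measurableSet_Ioc fun a ha => ?_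
  rw [integral_mul_const, hint a ha]
  field_simp

omit h₁ in
lemma continuousAt_singularWeight {r : ℝ} (hr : r ∈ Set.Ioo (0 : ℝ) 1) :
    ContinuousAt (singularWeight α) r := by
  have h := rpow_two_div_lt_one h₀ hr
  have hc : ContinuousAt (fun r : ℝ => (1 - r ^ (2 / α)) ^ (-α)) r := by
    refine ContinuousAt.rpow_const ?_ (Or.inl (by linarith))
    exact continuousAt_const.sub (continuousAt_id.rpow_const (Or.inl hr.1.ne'))
  refine hc.congr ?_
  filter_upwards [Ioo_mem_nhds hr.1 hr.2] with x hx
  exact (singularWeight_of_mem hx).symm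

/-- Both terms of the integral equation are integrals from `x` to `c` of functions continuous at
`y`; the fundamental theorem of calculus applies. -/
lemma hasDerivAt_fluxProfile {y : ℝ} (hy : 0 < y) (hyc : y < c) :
    HasDerivAt (fluxProfile α c) (-(1 / Real.Gamma (1 - α) *
      (singularWeight α (y / c) + memoryTerm α c y))) y := by
  have hc : 0 < c := hy.trans hyc
  have hR : ContinuousOn (memoryTerm α c) (Set.Ioi 0) := fun z hz =>
    (continuousAt_memoryTerm h₀ h₁ hc.le hz).continuousWithinAt
  have hRi : ∀ {x : ℝ}, 0 < x → x ≤ c → IntervalIntegrable (memoryTerm α c) volume x c :=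
    fun hx hxc => (hR.mono fun z hz => by
      rw [Set.uIcc_of_le hxc] at hz; exact hx.trans_le hz.1).intervalIntegrable
  have hφi (x : ℝ) := intervalIntegrable_singularWeight_div h₀ h₁ x c hc
  have hφm : Measurable fun z : ℝ => singularWeight α (z / c) :=
    measurable_singularWeight.comp (by fun_prop)
  have hrepr : ∀ x ∈ Set.Ioo 0 c, fluxProfile α c x = 1 / Real.Gamma (1 - α) *
      ∫ z in x..c, (singularWeight α (z / c) + memoryTerm α c z) := fun x hx => by
    rw [fluxProfile_eq_add h₀ h₁ (Set.Ioo_subset_Icc_self hx),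
      integral_baseKernel_mul_fluxProfile h₀ h₁ hc.le hx.2.le,
      ← integral_singularWeight_div h₀ h₁ hc le_rfl,
      intervalIntegral.integral_add (hφi x) (hRi hx.1 hx.2.le), mul_add]
  have hd : HasDerivAt (fun x => ∫ z in x..c, (singularWeight α (z / c) + memoryTerm α c z))
      (-(singularWeight α (y / c) + memoryTerm α c y)) y := by
    refine intervalIntegral.integral_hasDerivAt_left ((hφi y).add (hRi hy hyc.le)) ?_ ?_
    · exact ⟨Set.Ioi 0, Ioi_mem_nhds hy, hφm.aestronglyMeasurable.add
        (hR.aestronglyMeasurable measurableSet_Ioi)⟩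
    · refine ContinuousAt.add ?_ (continuousAt_memoryTerm h₀ h₁ hc.le hy)
      exact ContinuousAt.comp (g := singularWeight α) (f := fun z => z / c)
        (continuousAt_singularWeight h₀ ⟨by positivity, (div_lt_one hc).2 hyc⟩) (by fun_prop)
  have := (hd.const_mul (1 / Real.Gamma (1 - α))).congr_of_eventuallyEq
    (f₁ := fluxProfile α c) (by
      filter_upwards [Ioo_mem_nhds hy hyc] with x hx using hrepr x hx)
  rwa [mul_neg] at this

end Memory

/-! ### Abel integrals of functions with a weakly singular derivative. -/

lemma integral_beta {a b : ℝ} (ha : 0 < a) (hb : 0 < b) :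
    ∫ x in (0 : ℝ)..1, x ^ (a - 1) * (1 - x) ^ (b - 1) =
      Real.Gamma a * Real.Gamma b / Real.Gamma (a + b) := by
  have h := ProbabilityTheory.beta_eq_betaIntegralReal a b ha hb
  rw [ProbabilityTheory.beta] at h
  rw [h, Complex.betaIntegral, intervalIntegral.integral_of_le zero_le_one,
    intervalIntegral.integral_of_le zero_le_one, ← RCLike.re_to_complex, ← integral_re]
  · refine setIntegral_congr_fun measurableSet_Ioc fun x ⟨hx₁, hx₂⟩ => ?_
    norm_cast
    rw [← Complex.ofReal_cpow, ← Complex.ofReal_cpow, RCLike.re_to_complex,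
      Complex.re_mul_ofReal, Complex.ofReal_re]
    all_goals linarith
  · have := Complex.betaIntegral_convergent (u := a) (v := b) (by simpa) (by simpa)
    rwa [intervalIntegrable_iff_integrableOn_Ioc_of_le zero_le_one] at this

/-- `∫_0^r (r-s)^(α-1) j(s) ds`, rescaled to the unit interval. -/
def abelIntegral (α : ℝ) (j : ℝ → ℝ) (r : ℝ) : ℝ :=
  ∫ θ in (0 : ℝ)..1, (1 - θ) ^ (α - 1) * (r ^ α * j (r * θ))

/-- The derivative of `abelIntegral α j` when `j'(s) = s^(-α) q(s)`. -/
def abelDeriv (α : ℝ) (j q : ℝ → ℝ) (r : ℝ) : ℝ :=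
  ∫ θ in (0 : ℝ)..1, (1 - θ) ^ (α - 1) * (α * r ^ (α - 1) * j (r * θ) + θ ^ (1 - α) * q (r * θ))

section Abel

variable {α : ℝ} {j q : ℝ → ℝ} (h₀ : 0 < α) (h₁ : α < 1)
  (hj : ContinuousOn j (Set.Ici 0)) (hq : ContinuousOn q (Set.Ici 0))
  (hd : ∀ s, 0 < s → HasDerivAt j (s ^ (-α) * q s) s)

lemma measurable_one_sub_rpow (β : ℝ) : Measurable fun θ : ℝ => (1 - θ) ^ β := by
  fun_prop

lemma continuousOn_comp_mul {f : ℝ → ℝ} (hf : ContinuousOn f (Set.Ici 0)) {r : ℝ} (hr : 0 ≤ r) :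
    ContinuousOn (fun θ => f (r * θ)) (Set.Ici 0) :=
  hf.comp (by fun_prop) fun _ hθ => mul_nonneg hr hθ

include h₀ in
lemma intervalIntegrable_abelWeight (a b : ℝ) :
    IntervalIntegrable (fun θ : ℝ => (1 - θ) ^ (α - 1)) volume a b := by
  simpa using intervalIntegrable_one_sub_rpow (α := 1 - α) (by linarith) a b

include h₁ in
lemma continuousOn_abel_right (hj : ContinuousOn j (Set.Ici 0)) (hq : ContinuousOn q (Set.Ici 0))
    {r : ℝ} (hr : 0 ≤ r) :
    ContinuousOn (fun θ => α * r ^ (α - 1) * j (r * θ) + θ ^ (1 - α) * q (r * θ))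
      (Set.Ici 0) := by
  have h := (Real.continuous_rpow_const (by linarith : 0 ≤ 1 - α)).continuousOn (s := Set.Ici 0)
  exact (continuousOn_const.mul (continuousOn_comp_mul hj hr)).add
    (h.mul (continuousOn_comp_mul hq hr))

include h₀ in
lemma intervalIntegrable_abelIntegrand (hj : ContinuousOn j (Set.Ici 0)) {r : ℝ} (hr : 0 ≤ r) :
    IntervalIntegrable (fun θ => (1 - θ) ^ (α - 1) * (r ^ α * j (r * θ))) volume 0 1 := by
  refine (intervalIntegrable_abelWeight h₀ 0 1).mul_continuousOn ?_
  refine (continuousOn_const.mul (continuousOn_comp_mul hj hr)).mono fun x hx => ?_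
  rw [Set.uIcc_of_le zero_le_one] at hx
  exact hx.1

-- On the unit interval the singular factor `(1-θ)^(α-1)` is independent of `r`, so differentiation
-- under the integral is legitimate. In `r^α (rθ)^(-α) θ = θ^(1-α)` the singularity of `j'` cancels.
include h₀ h₁ hj hq hd in
lemma hasDerivAt_abelIntegral {r : ℝ} (hr : 0 < r) :
    HasDerivAt (abelIntegral α j) (abelDeriv α j q r) r := by
  have hsub : Set.Icc (0 : ℝ) (2 * r) ⊆ Set.Ici 0 := fun x hx => hx.1
  obtain ⟨K, hK⟩ := isCompact_Icc.exists_bound_of_continuousOn (hj.mono hsub)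
  obtain ⟨L, hL⟩ := isCompact_Icc.exists_bound_of_continuousOn (hq.mono hsub)
  have hIoc : Set.uIoc (0 : ℝ) 1 ⊆ Set.Ici 0 := fun x hx => by
    rw [Set.uIoc_of_le zero_le_one] at hx; exact hx.1.le
  have hr2 : r / 2 < r := half_lt_self hr
  refine (intervalIntegral.hasDerivAt_integral_of_dominated_loc_of_deriv_le
    (F := fun r θ => (1 - θ) ^ (α - 1) * (r ^ α * j (r * θ)))
    (F' := fun r θ => (1 - θ) ^ (α - 1) *
      (α * r ^ (α - 1) * j (r * θ) + θ ^ (1 - α) * q (r * θ)))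
    (s := Set.Ioo (r / 2) (2 * r))
    (bound := fun θ => (1 - θ) ^ (α - 1) * (α * (r / 2) ^ (α - 1) * K + L))
    (Ioo_mem_nhds hr2 (by linarith)) ?_ (intervalIntegrable_abelIntegrand h₀ hj hr.le) ?_ ?_
    ((intervalIntegrable_abelWeight h₀ 0 1).mul_const _) ?_).2
  · filter_upwards [lt_mem_nhds hr] with x hx
    exact (measurable_one_sub_rpow _).aestronglyMeasurable.mul
      (((continuousOn_const.mul (continuousOn_comp_mul hj hx.le)).mono hIoc).aestronglyMeasurable
        measurableSet_uIoc)
  · exact (measurable_one_sub_rpow _).aestronglyMeasurable.mul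
      (((continuousOn_abel_right h₁ hj hq hr.le).mono hIoc).aestronglyMeasurable
        measurableSet_uIoc)
  · refine Eventually.of_forall fun θ hθ x hx => ?_
    rw [Set.uIoc_of_le zero_le_one] at hθ
    have hx0 : 0 < x := by linarith [hx.1]
    have hmem : x * θ ∈ Set.Icc 0 (2 * r) :=
      ⟨mul_nonneg hx0.le hθ.1.le, by nlinarith [hx.2, hθ.1, hθ.2]⟩
    have hw : 0 ≤ (1 - θ) ^ (α - 1) := Real.rpow_nonneg (by linarith [hθ.2]) _
    rw [norm_mul, Real.norm_of_nonneg hw]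
    refine mul_le_mul_of_nonneg_left ((norm_add_le _ _).trans (add_le_add ?_ ?_)) hw
    · rw [norm_mul, Real.norm_of_nonneg (by positivity)]
      refine mul_le_mul (mul_le_mul_of_nonneg_left ?_ h₀.le) (hK _ hmem) (norm_nonneg _)
        (by positivity)
      exact Real.rpow_le_rpow_of_nonpos (by linarith) hx.1.le (by linarith)
    · rw [norm_mul, Real.norm_of_nonneg (Real.rpow_nonneg hθ.1.le _)]
      refine (mul_le_of_le_one_left (norm_nonneg _) ?_).trans (hL _ hmem)
      exact Real.rpow_le_one hθ.1.le hθ.2 (by linarith)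
  · refine Eventually.of_forall fun θ hθ x hx => ?_
    rw [Set.uIoc_of_le zero_le_one] at hθ
    have hx0 : 0 < x := by linarith [hx.1]
    refine HasDerivAt.const_mul _ ?_
    have hmul : HasDerivAt (fun x : ℝ => x * θ) θ x := by
      simpa using (hasDerivAt_id x).mul_const θ
    have h := (Real.hasDerivAt_rpow_const (p := α) (Or.inl hx0.ne')).mul
      ((hd (x * θ) (mul_pos hx0 hθ.1)).comp x hmul)
    refine h.congr_deriv ?_
    have e₁ : x ^ α * x ^ (-α) = 1 := by rw [← Real.rpow_add hx0]; simp
    have e₂ : θ ^ (-α) * θ = θ ^ (1 - α) := by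
      rw [sub_eq_add_neg, add_comm, Real.rpow_add hθ.1, Real.rpow_one]
    rw [Real.mul_rpow hx0.le hθ.1.le, ← e₂, Function.comp_apply]
    linear_combination (θ ^ (-α) * q (x * θ) * θ) * e₁

-- By l'Hôpital `j(s)` behaves like `q(0) s^(1-α)/(1-α)`, so the integrand of `abelDeriv` converges
-- for each `θ`, and dominated convergence leaves a beta integral.
include h₀ h₁ hj hq hd in
lemma tendsto_abelDeriv (hj0 : j 0 = 0) :
    Tendsto (abelDeriv α j q) (𝓝[>] 0) (𝓝 (q 0 * (Real.Gamma α * Real.Gamma (1 - α)))) := by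
  have h1α : 0 < 1 - α := by linarith
  have hjt : Tendsto j (𝓝[>] 0) (𝓝 0) := by
    have := (hj 0 Set.self_mem_Ici).mono_left (nhdsWithin_mono 0 Set.Ioi_subset_Ici_self)
    rwa [hj0] at this
  have hqt : Tendsto q (𝓝[>] 0) (𝓝 (q 0)) :=
    (hq 0 Set.self_mem_Ici).mono_left (nhdsWithin_mono 0 Set.Ioi_subset_Ici_self)
  have hJ : Tendsto (fun s => j s / s ^ (1 - α)) (𝓝[>] 0) (𝓝 (q 0 / (1 - α))) := by
    refine HasDerivAt.lhopital_zero_nhdsGT (f' := fun s => s ^ (-α) * q s)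
      (g' := fun s => (1 - α) * s ^ (-α)) ?_ ?_ ?_ hjt ?_ ?_
    · filter_upwards [self_mem_nhdsWithin] with s hs using hd s hs
    · filter_upwards [self_mem_nhdsWithin] with s hs
      have := Real.hasDerivAt_rpow_const (x := s) (p := 1 - α) (Or.inl (ne_of_gt hs))
      rwa [sub_sub_cancel_left] at this
    · filter_upwards [self_mem_nhdsWithin] with s hs
      exact (mul_pos h1α (Real.rpow_pos_of_pos hs _)).ne'
    · have := (Real.continuous_rpow_const h1α.le).tendsto 0
      rw [Real.zero_rpow h1α.ne'] at this
      exact this.mono_left nhdsWithin_le_nhds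
    · refine (hqt.div_const (1 - α)).congr' ?_
      filter_upwards [self_mem_nhdsWithin] with s hs
      have := Real.rpow_pos_of_pos hs (-α)
      field_simp
  -- Here `α/(1-α) + 1 = 1/(1-α)`, and the beta integral with parameters `2-α` and `α` is `(1-α)
  -- Γ(1-α) Γ(α)`, as `Γ(2) = 1`.
  have hval : ∫ θ in (0 : ℝ)..1, (1 - θ) ^ (α - 1) *
      (θ ^ (1 - α) * (α * (q 0 / (1 - α)) + q 0)) =
      q 0 * (Real.Gamma α * Real.Gamma (1 - α)) := by
    have hB := integral_beta (a := 2 - α) (b := α) (by linarith) h₀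
    have hG : Real.Gamma (2 - α) = (1 - α) * Real.Gamma (1 - α) := by
      rw [← Real.Gamma_add_one h1α.ne']; ring_nf
    rw [sub_add_cancel, Real.Gamma_two, div_one, hG] at hB
    have hfun : ∀ θ : ℝ, (1 - θ) ^ (α - 1) * (θ ^ (1 - α) * (α * (q 0 / (1 - α)) + q 0)) =
        θ ^ (2 - α - 1) * (1 - θ) ^ (α - 1) * (q 0 / (1 - α)) := fun θ => by
      rw [show 2 - α - 1 = 1 - α by ring]
      field_simp
      ring
    simp_rw [hfun]
    rw [intervalIntegral.integral_mul_const, hB]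
    field_simp
  rw [← hval]
  set K := |q 0 / (1 - α)| + 1
  set L := |q 0| + 1
  have hJb : ∀ᶠ s in 𝓝[>] (0 : ℝ), |j s / s ^ (1 - α)| < K :=
    hJ.abs.eventually_lt_const (lt_add_one _)
  have hqb : ∀ᶠ s in 𝓝[>] (0 : ℝ), |q s| < L := hqt.abs.eventually_lt_const (lt_add_one _)
  obtain ⟨δ, hδ, hδb⟩ := mem_nhdsGT_iff_exists_Ioo_subset.1 (hJb.and hqb)
  have hIoc : Set.uIoc (0 : ℝ) 1 ⊆ Set.Ici 0 := fun x hx => by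
    rw [Set.uIoc_of_le zero_le_one] at hx; exact hx.1.le
  have hform : ∀ {r θ : ℝ}, 0 < r → 0 < θ →
      α * r ^ (α - 1) * j (r * θ) + θ ^ (1 - α) * q (r * θ) =
      θ ^ (1 - α) * (α * (j (r * θ) / (r * θ) ^ (1 - α)) + q (r * θ)) := by
    intro r θ hr hθ
    rw [Real.mul_rpow hr.le hθ.le, show α - 1 = -(1 - α) by ring, Real.rpow_neg hr.le]
    have := Real.rpow_pos_of_pos hr (1 - α)
    have := Real.rpow_pos_of_pos hθ (1 - α)
    field_simp
  refine intervalIntegral.tendsto_integral_filter_of_dominated_convergence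
    (fun θ => (1 - θ) ^ (α - 1) * (α * K + L)) ?_ ?_
    ((intervalIntegrable_abelWeight h₀ 0 1).mul_const _) ?_
  · filter_upwards [self_mem_nhdsWithin] with r hr
    exact (measurable_one_sub_rpow _).aestronglyMeasurable.mul
      (((continuousOn_abel_right h₁ hj hq (le_of_lt hr)).mono hIoc).aestronglyMeasurable
        measurableSet_uIoc)
  · filter_upwards [Ioo_mem_nhdsGT hδ] with r hr
    refine Eventually.of_forall fun θ hθ => ?_
    rw [Set.uIoc_of_le zero_le_one] at hθ
    have hw : 0 ≤ (1 - θ) ^ (α - 1) := Real.rpow_nonneg (by linarith [hθ.2]) _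
    have hb := hδb (show r * θ ∈ Set.Ioo 0 δ from
      ⟨mul_pos hr.1 hθ.1, (mul_le_of_le_one_right hr.1.le hθ.2).trans_lt hr.2⟩)
    rw [norm_mul, Real.norm_of_nonneg hw, hform hr.1 hθ.1, norm_mul,
      Real.norm_of_nonneg (Real.rpow_nonneg hθ.1.le _)]
    refine mul_le_mul_of_nonneg_left ?_ hw
    refine (mul_le_of_le_one_left (norm_nonneg _)
      (Real.rpow_le_one hθ.1.le hθ.2 h1α.le)).trans ?_
    refine (norm_add_le _ _).trans (add_le_add ?_ hb.2.le)
    rw [norm_mul, Real.norm_of_nonneg h₀.le]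
    exact mul_le_mul_of_nonneg_left hb.1.le h₀.le
  · refine Eventually.of_forall fun θ hθ => ?_
    rw [Set.uIoc_of_le zero_le_one] at hθ
    have hmul : Tendsto (fun r : ℝ => r * θ) (𝓝[>] 0) (𝓝[>] 0) := by
      refine tendsto_nhdsWithin_iff.2 ⟨?_, ?_⟩
      · have : Continuous fun r : ℝ => r * θ := by fun_prop
        simpa using (this.tendsto 0).mono_left nhdsWithin_le_nhds
      · filter_upwards [self_mem_nhdsWithin] with r hr using mul_pos hr hθ.1
    refine Tendsto.const_mul _ ?_
    refine ((((hJ.comp hmul).const_mul α).add (hqt.comp hmul)).const_mul (θ ^ (1 - α))).congr' ?_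
    filter_upwards [self_mem_nhdsWithin] with r hr
    exact (hform hr hθ.1).symm

end Abel

/-! ### The interface curve and passage times. -/

section Interface

variable {α c : ℝ} (h₀ : 0 < α)

lemma interfaceCurve_mul_rpow {t : ℝ} (ht : 0 < t) :
    interfaceCurve α c t * t ^ (-(α / 2)) = c := by
  rw [interfaceCurve, mul_assoc, ← Real.rpow_add ht, add_neg_cancel, Real.rpow_zero, mul_one]

lemma mul_rpow_lt_iff {x t : ℝ} (ht : 0 < t) :
    x * t ^ (-(α / 2)) < c ↔ x < interfaceCurve α c t := by
  rw [Real.rpow_neg ht.le, ← div_eq_mul_inv, div_lt_iff₀ (Real.rpow_pos_of_pos ht _),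
    interfaceCurve]

lemma mul_rpow_le_iff {x t : ℝ} (ht : 0 < t) :
    x * t ^ (-(α / 2)) ≤ c ↔ x ≤ interfaceCurve α c t := by
  rw [Real.rpow_neg ht.le, ← div_eq_mul_inv, div_le_iff₀ (Real.rpow_pos_of_pos ht _),
    interfaceCurve]

lemma hasDerivAt_interfaceCurve {t : ℝ} (ht : 0 < t) :
    HasDerivAt (interfaceCurve α c) (c * (α / 2 * t ^ (α / 2 - 1))) t :=
  (Real.hasDerivAt_rpow_const (Or.inl ht.ne')).const_mul c

include h₀

lemma continuous_interfaceCurve : Continuous (interfaceCurve α c) :=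
  continuous_const.mul (Real.continuous_rpow_const (by positivity))

lemma strictMonoOn_interfaceCurve (hc : 0 < c) :
    StrictMonoOn (interfaceCurve α c) (Set.Ici 0) := fun x hx _ _ hxy =>
  mul_lt_mul_of_pos_left (Real.rpow_lt_rpow hx hxy (by positivity)) hc

lemma interfaceCurve_rpow (hc : 0 < c) {a : ℝ} (ha : 0 ≤ a) :
    interfaceCurve α c ((a / c) ^ (2 / α)) = a := by
  rw [interfaceCurve, ← Real.rpow_mul (by positivity), show 2 / α * (α / 2) = 1 by field_simp,
    Real.rpow_one]
  field_simp

lemma curveInv_interfaceCurve (hc : 0 < c) {τ : ℝ} (hτ : 0 ≤ τ) :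
    curveInv (interfaceCurve α c) (interfaceCurve α c τ) = τ :=
  (strictMonoOn_interfaceCurve h₀ hc).injOn.leftInvOn_invFunOn hτ

/-- Points of the liquid region are parametrised by the passage time `τ` of the interface, which
makes `s⁻¹` explicit throughout. -/
lemma exists_eq_interfaceCurve (hc : 0 < c) {a t : ℝ} (ht : 0 < t) (ha : 0 < a)
    (hat : a < interfaceCurve α c t) :
    ∃ τ, 0 < τ ∧ τ < t ∧ a = interfaceCurve α c τ := by
  have hpos : 0 < (a / c) ^ (2 / α) := Real.rpow_pos_of_pos (by positivity) _
  have he := interfaceCurve_rpow h₀ hc ha.le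
  refine ⟨(a / c) ^ (2 / α), hpos, ?_, he.symm⟩
  rw [← he] at hat
  exact (strictMonoOn_interfaceCurve h₀ hc).lt_iff_lt hpos.le ht.le |>.1 hat

/-- The exponent `2/α` in the weight undoes the `α/2` of the similarity variable; this links the
kernel `φ` to the Caputo kernel. -/
lemma rpow_mul_singularWeight {τ t : ℝ} (hτ : 0 < τ) (hτt : τ < t) :
    t ^ (-α) * singularWeight α ((τ / t) ^ (α / 2)) = (t - τ) ^ (-α) := by
  have ht := hτ.trans hτt
  have h1 : τ / t < 1 := (div_lt_one ht).2 hτt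
  have hp : 0 < τ / t := by positivity
  rw [singularWeight_of_mem ⟨Real.rpow_pos_of_pos hp _,
      Real.rpow_lt_one hp.le h1 (by positivity)⟩, ← Real.rpow_mul hp.le,
    show α / 2 * (2 / α) = 1 by field_simp, Real.rpow_one, ← Real.mul_rpow ht.le (by linarith)]
  congr 1
  field_simp

end Interface

/-! ### The self-similar temperature and the diffusion equation. -/

/-- The self-similar profile `f`, where `u(x,t) = f(x t^(-α/2))`. -/
def temperatureProfile (α c z : ℝ) : ℝ := ∫ y in z..c, fluxProfile α c y

section Temperature

variable {α c : ℝ} (h₀ : 0 < α) (h₁ : α < 1)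
include h₀ h₁

lemma temperature_eq {x t : ℝ} (ht : 0 < t) (hx : 0 ≤ x) (hxt : x ≤ interfaceCurve α c t) :
    temperature α c x t = temperatureProfile α c (x * t ^ (-(α / 2))) :=
  integral_H_mul_G h₀ h₁ (mul_nonneg hx (Real.rpow_nonneg ht.le _)) ((mul_rpow_le_iff ht).2 hxt)

lemma hasDerivAt_temperatureProfile (hc : 0 ≤ c) (z : ℝ) :
    HasDerivAt (temperatureProfile α c) (-fluxProfile α c z) z := by
  have hg := continuous_fluxProfile (c := c) h₀ h₁ hc
  exact intervalIntegral.integral_hasDerivAt_left (hg.intervalIntegrable _ _)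
    (hg.stronglyMeasurableAtFilter _ _) hg.continuousAt

lemma continuous_temperatureProfile (hc : 0 ≤ c) : Continuous (temperatureProfile α c) :=
  continuous_iff_continuousAt.2 fun z => (hasDerivAt_temperatureProfile h₀ h₁ hc z).continuousAt

lemma temperatureProfile_zero_pos (hc : 0 < c) : 0 < temperatureProfile α c 0 :=
  intervalIntegral.intervalIntegral_pos_of_pos_on
    ((continuous_fluxProfile h₀ h₁ hc.le).intervalIntegrable _ _)
    (fun _ hy => fluxProfile_pos h₀ h₁ hy.1.le hy.2) hc

lemma hasDerivAt_temperature_left (hc : 0 < c) {x t : ℝ} (ht : 0 < t) (hx : 0 < x)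
    (hxt : x < interfaceCurve α c t) :
    HasDerivAt (fun y => temperature α c y t)
      (-(t ^ (-(α / 2)) * fluxProfile α c (x * t ^ (-(α / 2))))) x := by
  have hmul : HasDerivAt (fun y : ℝ => y * t ^ (-(α / 2))) (t ^ (-(α / 2))) x := by
    simpa using (hasDerivAt_id x).mul_const (t ^ (-(α / 2)))
  have h := (hasDerivAt_temperatureProfile h₀ h₁ hc.le (x * t ^ (-(α / 2)))).comp x hmul
  refine (h.congr_deriv (by ring)).congr_of_eventuallyEq ?_
  filter_upwards [Ioo_mem_nhds hx hxt] with y hy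
  exact temperature_eq h₀ h₁ ht hy.1.le hy.2.le

lemma dx_temperature (hc : 0 < c) {x t : ℝ} (ht : 0 < t) (hx : 0 < x)
    (hxt : x < interfaceCurve α c t) :
    dx (temperature α c) x t = -(t ^ (-(α / 2)) * fluxProfile α c (x * t ^ (-(α / 2)))) :=
  (hasDerivAt_temperature_left h₀ h₁ hc ht hx hxt).deriv

lemma hasDerivAt_dx_temperature (hc : 0 < c) {x t : ℝ} (ht : 0 < t) (hx : 0 < x)
    (hxt : x < interfaceCurve α c t) :
    HasDerivAt (fun y => dx (temperature α c) y t)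
      (t ^ (-α) * (1 / Real.Gamma (1 - α) * (singularWeight α (x * t ^ (-(α / 2)) / c) +
        memoryTerm α c (x * t ^ (-(α / 2)))))) x := by
  have hmul : HasDerivAt (fun y : ℝ => y * t ^ (-(α / 2))) (t ^ (-(α / 2))) x := by
    simpa using (hasDerivAt_id x).mul_const (t ^ (-(α / 2)))
  have hz : 0 < x * t ^ (-(α / 2)) := mul_pos hx (Real.rpow_pos_of_pos ht _)
  have h := (((hasDerivAt_fluxProfile h₀ h₁ hz ((mul_rpow_lt_iff ht).2 hxt)).comp x
    hmul).const_mul (t ^ (-(α / 2)))).neg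
  have e : t ^ (-α) = t ^ (-(α / 2)) * t ^ (-(α / 2)) := by
    rw [← Real.rpow_add ht]; congr 1; ring
  refine (h.congr_deriv (by rw [e]; ring)).congr_of_eventuallyEq ?_
  filter_upwards [Ioo_mem_nhds hx hxt] with y hy
  exact dx_temperature h₀ h₁ hc ht hy.1 hy.2

lemma hasDerivAt_temperature_right (hc : 0 < c) {x t : ℝ} (ht : 0 < t) (hx : 0 < x)
    (hxt : x < interfaceCurve α c t) :
    HasDerivAt (fun τ => temperature α c x τ)
      (x * (α / 2 * t ^ (-(α / 2) - 1)) * fluxProfile α c (x * t ^ (-(α / 2)))) t := by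
  have hpow : HasDerivAt (fun τ : ℝ => x * τ ^ (-(α / 2)))
      (x * (-(α / 2) * t ^ (-(α / 2) - 1))) t :=
    (Real.hasDerivAt_rpow_const (Or.inl ht.ne')).const_mul x
  have h := (hasDerivAt_temperatureProfile h₀ h₁ hc.le (x * t ^ (-(α / 2)))).comp t hpow
  refine (h.congr_deriv (by ring)).congr_of_eventuallyEq ?_
  filter_upwards [lt_mem_nhds ht,
    (continuous_interfaceCurve h₀).continuousAt.eventually (lt_mem_nhds hxt)] with τ hτ hτx
  exact temperature_eq h₀ h₁ hτ hx.le hτx.le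

lemma continuousOn_temperature (hc : 0 ≤ c) :
    ContinuousOn (fun q : ℝ × ℝ => temperature α c q.1 q.2)
      {q | 0 < q.2 ∧ 0 ≤ q.1 ∧ q.1 ≤ interfaceCurve α c q.2} := by
  refine ContinuousOn.congr (f := fun q : ℝ × ℝ =>
    temperatureProfile α c (q.1 * q.2 ^ (-(α / 2)))) ?_ fun q hq =>
      temperature_eq h₀ h₁ hq.1 hq.2.1 hq.2.2
  refine (continuous_temperatureProfile h₀ h₁ hc).comp_continuousOn ?_
  exact continuousOn_fst.mul (continuousOn_snd.rpow_const fun q hq => Or.inl hq.1.ne')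

omit h₁ in
lemma lt_interfaceCurve (hc : 0 < c) {τ₀ τ : ℝ} (hτ₀ : 0 < τ₀) (hτ : τ₀ < τ) :
    interfaceCurve α c τ₀ < interfaceCurve α c τ :=
  strictMonoOn_interfaceCurve h₀ hc hτ₀.le (hτ₀.trans hτ).le hτ

omit h₀ h₁ in
lemma interfaceCurve_pos (hc : 0 < c) {τ : ℝ} (hτ : 0 < τ) : 0 < interfaceCurve α c τ :=
  mul_pos hc (Real.rpow_pos_of_pos hτ _)

omit h₀ h₁ in
lemma continuousOn_profile_rpow {f : ℝ → ℝ} (hf : Continuous f) (x δ : ℝ) :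
    ContinuousOn (fun τ : ℝ => τ ^ δ * f (x * τ ^ (-(α / 2)))) (Set.Ioi 0) := by
  have hp (e : ℝ) : ContinuousOn (fun τ : ℝ => τ ^ e) (Set.Ioi 0) := fun τ hτ =>
    (Real.continuousAt_rpow_const τ e (Or.inl (ne_of_gt hτ))).continuousWithinAt
  exact (hp δ).mul (hf.comp_continuousOn (continuousOn_const.mul (hp _)))

omit h₀ h₁ in
lemma intervalIntegrable_sub_rpow {β : ℝ} (hβ : -1 < β) (a t : ℝ) :
    IntervalIntegrable (fun τ : ℝ => (t - τ) ^ β) volume a t := by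
  have := (intervalIntegral.intervalIntegrable_rpow' (a := t - a) (b := t - t) hβ).comp_sub_left t
  simpa using this

omit h₀ h₁ in
lemma uIcc_subset_Ioi {τ₀ t : ℝ} (hτ₀ : 0 < τ₀) (ht : τ₀ < t) :
    Set.uIcc τ₀ t ⊆ Set.Ioi 0 := fun x hx => by
  rw [Set.uIcc_of_le ht.le] at hx; exact hτ₀.trans_le hx.1

/-- The open interval matters: at `τ = τ₀` the point lies on the interface, where the derivative of
`temperature` is not computed. -/
lemma caputo_integrand_eqOn (hc : 0 < c) {τ₀ t : ℝ} (hτ₀ : 0 < τ₀) (ht : τ₀ < t) :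
    Set.EqOn (fun τ => (t - τ) ^ (-α) *
        deriv (fun r => temperature α c (interfaceCurve α c τ₀) r) τ)
      (fun τ => (t - τ) ^ (-α) * (interfaceCurve α c τ₀ * (α / 2) * (τ ^ (-(α / 2) - 1) *
        fluxProfile α c (interfaceCurve α c τ₀ * τ ^ (-(α / 2)))))) (Set.uIoo τ₀ t) := by
  intro τ hτ
  rw [Set.uIoo_of_le ht.le] at hτ
  simp only
  rw [(hasDerivAt_temperature_right h₀ h₁ hc (hτ₀.trans hτ.1) (interfaceCurve_pos hc hτ₀)
    (lt_interfaceCurve h₀ hc hτ₀ hτ.1)).deriv]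
  ring

lemma intervalIntegrable_caputo_explicit (hc : 0 < c) {τ₀ t : ℝ} (x : ℝ) (hτ₀ : 0 < τ₀)
    (ht : τ₀ < t) :
    IntervalIntegrable (fun τ => (t - τ) ^ (-α) * (x * (α / 2) * (τ ^ (-(α / 2) - 1) *
        fluxProfile α c (x * τ ^ (-(α / 2)))))) volume τ₀ t :=
  (intervalIntegrable_sub_rpow (by linarith) τ₀ t).mul_continuousOn
    (continuousOn_const.mul ((continuousOn_profile_rpow
      (continuous_fluxProfile h₀ h₁ hc.le) x _).mono (uIcc_subset_Ioi hτ₀ ht)))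

/-- The substitution `μ = x τ^(-α/2)` maps `[τ₀,t]` decreasingly onto `[z,c]` and gives `(t-τ)^(-α)
= t^(-α) φ(z/μ)`. The missing range `[0,z]` of the memory term contributes nothing, since `φ(z/μ) =
0` for `μ ≤ z`. -/
lemma integral_caputo_explicit (hc : 0 < c) {τ₀ t : ℝ} (hτ₀ : 0 < τ₀) (ht : τ₀ < t) :
    ∫ τ in τ₀..t, (t - τ) ^ (-α) * (interfaceCurve α c τ₀ * (α / 2) * (τ ^ (-(α / 2) - 1) *
        fluxProfile α c (interfaceCurve α c τ₀ * τ ^ (-(α / 2))))) =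
      t ^ (-α) * memoryTerm α c (interfaceCurve α c τ₀ * t ^ (-(α / 2))) := by
  have ht0 := hτ₀.trans ht
  set x := interfaceCurve α c τ₀ with hx
  have hx0 : 0 < x := interfaceCurve_pos hc hτ₀
  set z := x * t ^ (-(α / 2)) with hz
  have hz0 : 0 < z := mul_pos hx0 (Real.rpow_pos_of_pos ht0 _)
  have hzc : z < c := (mul_rpow_lt_iff ht0).2 (lt_interfaceCurve h₀ hc hτ₀ ht)
  have hg := continuous_fluxProfile (c := c) h₀ h₁ hc.le
  set φ : ℝ → ℝ := fun τ => x * τ ^ (-(α / 2)) with hφ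
  set φ' : ℝ → ℝ := fun τ => x * (-(α / 2) * τ ^ (-(α / 2) - 1)) with hφ'
  set F : ℝ → ℝ := fun μ => t ^ (-α) * (singularWeight α (z / μ) * fluxProfile α c μ) with hF
  have hpos : ∀ τ ∈ Set.Icc τ₀ t, 0 < τ := fun τ hτ => hτ₀.trans_le hτ.1
  have hφ₀ : φ τ₀ = c := interfaceCurve_mul_rpow hτ₀
  have hdiv : ∀ τ, 0 < τ → z / φ τ = (τ / t) ^ (α / 2) := fun τ hτ => by
    have h1 := Real.rpow_pos_of_pos hτ (α / 2)
    have h2 := Real.rpow_pos_of_pos ht0 (α / 2)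
    simp only [hz, hφ]
    rw [Real.div_rpow hτ.le ht0.le, Real.rpow_neg hτ.le, Real.rpow_neg ht0.le]
    field_simp
  have hderiv : ∀ τ, 0 < τ → HasDerivAt φ (φ' τ) τ := fun τ hτ =>
    (Real.hasDerivAt_rpow_const (Or.inl hτ.ne')).const_mul x
  have hcov : ∀ τ ∈ Set.Ioo τ₀ t, (F ∘ φ) τ * φ' τ = -((t - τ) ^ (-α) * (x * (α / 2) *
      (τ ^ (-(α / 2) - 1) * fluxProfile α c (x * τ ^ (-(α / 2)))))) := fun τ hτ => by
    have hτ0 := hτ₀.trans hτ.1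
    simp only [Function.comp_apply, hF]
    rw [hdiv τ hτ0, ← rpow_mul_singularWeight h₀ hτ0 hτ.2]
    simp only [hφ, hφ']
    ring
  have hφmem : ∀ τ ∈ Set.Ioo τ₀ t, φ τ ∈ Set.Ioo z c := fun τ hτ => by
    have hτ0 := hτ₀.trans hτ.1
    refine ⟨?_, (mul_rpow_lt_iff hτ0).2 (lt_interfaceCurve h₀ hc hτ₀ hτ.1)⟩
    exact mul_lt_mul_of_pos_left (Real.rpow_lt_rpow_of_neg hτ0 hτ.2 (by linarith)) hx0
  have hφmem' : φ '' Set.uIcc τ₀ t ⊆ Set.Icc z c := by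
    rintro _ ⟨τ, hτ, rfl⟩
    rw [Set.uIcc_of_le ht.le] at hτ
    refine ⟨?_, (mul_rpow_le_iff (hpos τ hτ)).2
      ((strictMonoOn_interfaceCurve h₀ hc).monotoneOn hτ₀.le (hpos τ hτ).le hτ.1)⟩
    exact mul_le_mul_of_nonneg_left
      (Real.rpow_le_rpow_of_nonpos (hpos τ hτ) hτ.2 (by linarith)) hx0.le
  have hFi : IntervalIntegrable F volume 0 c := by
    have h1 := (intervalIntegrable_singularWeight_inv (W := c / z) h₀ h₁
      ((one_le_div hz0).2 hzc.le)).comp_mul_right (c := z⁻¹)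
    have h2 : IntervalIntegrable (fun μ => singularWeight α (z / μ)) volume 0 c := by
      refine (IntervalIntegrable.congr (fun μ _ => ?_) h1).mono_set ?_
      · congr 1
        rw [one_div, mul_inv, inv_inv, div_eq_mul_inv, mul_comm]
      · rw [zero_div, div_inv_eq_mul, div_mul_cancel₀ _ hz0.ne']
    exact (h2.mul_continuousOn hg.continuousOn).const_mul _
  have hsub : Set.uIcc z c ⊆ Set.uIcc 0 c := Set.uIcc_subset_uIcc_right (by
    rw [Set.uIcc_of_le hc.le]; exact ⟨hz0.le, hzc.le⟩)
  -- The integrand may blow up at `τ = t`, that is at `μ = z`, so the change of variables is used in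
  -- the form that asks for continuity only in the interior, together with integrability.
  have hmain := intervalIntegral.integral_comp_mul_deriv''' (a := τ₀) (b := t) (f := φ) (f' := φ')
    (g := F)
    (fun τ hτ => (hderiv τ (uIcc_subset_Ioi hτ₀ ht hτ)).continuousAt.continuousWithinAt)
    (fun τ hτ => by
      rw [min_eq_left ht.le] at hτ
      exact (hderiv τ (hτ₀.trans hτ.1)).hasDerivWithinAt)
    (by
      rw [min_eq_left ht.le, max_eq_right ht.le]
      rintro _ ⟨τ, hτ, rfl⟩
      have hm := hφmem τ hτ
      have hm0 := hz0.trans hm.1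
      refine ContinuousAt.continuousWithinAt (continuousAt_const.mul (ContinuousAt.mul ?_
        hg.continuousAt))
      exact ContinuousAt.comp (g := singularWeight α) (f := fun μ => z / μ)
        (continuousAt_singularWeight h₀ ⟨by positivity, (div_lt_one hm0).2 hm.1⟩)
        (continuousAt_const.div continuousAt_id hm0.ne'))
    (by
      refine IntegrableOn.mono_set ?_ hφmem'
      exact (intervalIntegrable_iff_integrableOn_Icc_of_le hzc.le).1 (hFi.mono_set hsub))
    (by
      rw [Set.uIcc_of_le ht.le]
      refine (intervalIntegrable_iff_integrableOn_Icc_of_le ht.le).1 ?_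
      refine (intervalIntegrable_congr_uIoo fun τ hτ => ?_).2
        (intervalIntegrable_caputo_explicit h₀ h₁ hc x hτ₀ ht).neg
      rw [Set.uIoo_of_le ht.le] at hτ
      exact hcov τ hτ)
  rw [intervalIntegral.integral_congr_Ioo_of_le ht.le hcov, intervalIntegral.integral_neg, hφ₀,
    intervalIntegral.integral_symm (φ t), neg_inj] at hmain
  rw [hmain, memoryTerm, ← intervalIntegral.integral_const_mul,
    ← intervalIntegral.integral_add_adjacent_intervals (b := z) (a := 0) (c := c)
      (f := fun μ => t ^ (-α) * (singularWeight α (z / μ) * fluxProfile α c μ))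
      (hFi.mono_set (Set.uIcc_subset_uIcc_left (by
        rw [Set.uIcc_of_le hc.le]; exact ⟨hz0.le, hzc.le⟩))) (hFi.mono_set hsub),
    intervalIntegral.integral_congr_Ioo_of_le hz0.le (g := fun _ => (0 : ℝ))]
  · simp [hF, hφ, hz]
  · intro μ hμ
    simp [singularWeight_of_one_le ((one_le_div hμ.1).2 hμ.2.le)]

lemma caputo_temperature (hc : 0 < c) {τ₀ t : ℝ} (hτ₀ : 0 < τ₀) (ht : τ₀ < t) :
    caputo α τ₀ (fun τ => temperature α c (interfaceCurve α c τ₀) τ) t =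
      1 / Real.Gamma (1 - α) *
        (t ^ (-α) * memoryTerm α c (interfaceCurve α c τ₀ * t ^ (-(α / 2)))) := by
  have h := caputo_integrand_eqOn h₀ h₁ hc hτ₀ ht
  rw [Set.uIoo_of_le ht.le] at h
  rw [caputo, intervalIntegral.integral_congr_Ioo_of_le ht.le h,
    integral_caputo_explicit h₀ h₁ hc hτ₀ ht]

omit h₀ h₁ in
lemma interfaceCurve_mul_rpow_div (hc : 0 < c) {τ₀ t : ℝ} (hτ₀ : 0 < τ₀) (ht : 0 < t) :
    interfaceCurve α c τ₀ * t ^ (-(α / 2)) / c = (τ₀ / t) ^ (α / 2) := by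
  have h2 := Real.rpow_pos_of_pos ht (α / 2)
  rw [interfaceCurve, Real.div_rpow hτ₀.le ht.le, Real.rpow_neg ht.le]
  field_simp

lemma flux_integrand_eqOn (hc : 0 < c) {τ₀ t : ℝ} (hτ₀ : 0 < τ₀) (ht : τ₀ < t) :
    Set.EqOn (fun τ => (t - τ) ^ (α - 1) * dx (temperature α c) (interfaceCurve α c τ₀) τ)
      (fun τ => (t - τ) ^ (α - 1) * -(τ ^ (-(α / 2)) *
        fluxProfile α c (interfaceCurve α c τ₀ * τ ^ (-(α / 2))))) (Set.uIoo τ₀ t) := by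
  intro τ hτ
  rw [Set.uIoo_of_le ht.le] at hτ
  simp only
  rw [dx_temperature h₀ h₁ hc (hτ₀.trans hτ.1) (interfaceCurve_pos hc hτ₀)
    (lt_interfaceCurve h₀ hc hτ₀ hτ.1)]

lemma intervalIntegrable_flux (hc : 0 < c) {τ₀ t : ℝ} (hτ₀ : 0 < τ₀) (ht : τ₀ < t) :
    IntervalIntegrable (fun τ => (t - τ) ^ (α - 1) *
      dx (temperature α c) (interfaceCurve α c τ₀) τ) volume τ₀ t := by
  refine (intervalIntegrable_congr_uIoo (flux_integrand_eqOn h₀ h₁ hc hτ₀ ht)).2 ?_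
  exact (intervalIntegrable_sub_rpow (by linarith) τ₀ t).mul_continuousOn
    ((continuousOn_profile_rpow (continuous_fluxProfile h₀ h₁ hc.le) _ _).mono
      (uIcc_subset_Ioi hτ₀ ht)).neg

end Temperature

/-! ### The flux and the free boundary condition. -/

/-- The rescaled flux `(1+s)^(-α/2) g(c (1+s)^(-α/2))` at a fixed point, the time since the passage
of the interface being measured in units of the passage time. -/
def scaledFlux (α c s : ℝ) : ℝ :=
  (1 + s) ^ (-(α / 2)) * fluxProfile α c (c * (1 + s) ^ (-(α / 2)))

/-- The function `s^α` times the derivative of `scaledFlux`. -/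
def scaledFluxSlope (α c s : ℝ) : ℝ :=
  c * (α / 2) * (1 / Real.Gamma (1 - α)) / (1 + s) +
    s ^ α * (c * (α / 2) * (1 / Real.Gamma (1 - α)) * (1 + s) ^ (-α - 1) *
        memoryTerm α c (c * (1 + s) ^ (-(α / 2))) -
      α / 2 * (1 + s) ^ (-(α / 2) - 1) * fluxProfile α c (c * (1 + s) ^ (-(α / 2))))

section Flux

variable {α c : ℝ} (h₀ : 0 < α) (h₁ : α < 1) (hc : 0 < c)
include h₀ h₁ hc

omit h₀ h₁ hc in
lemma continuousOn_one_add_rpow (e : ℝ) :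
    ContinuousOn (fun s : ℝ => (1 + s) ^ e) (Set.Ici 0) := by
  refine ContinuousOn.rpow_const (by fun_prop) fun s hs => Or.inl ?_
  have : (0 : ℝ) ≤ s := hs
  linarith

lemma continuousOn_scaledFlux : ContinuousOn (scaledFlux α c) (Set.Ici 0) :=
  (continuousOn_one_add_rpow _).mul ((continuous_fluxProfile h₀ h₁ hc.le).comp_continuousOn
    (continuousOn_const.mul (continuousOn_one_add_rpow _)))

omit h₀ h₁ in
lemma scaledFlux_zero : scaledFlux α c 0 = 0 := by
  simp [scaledFlux, fluxProfile_eq_zero hc.le le_rfl]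

omit h₁ hc in
lemma scaledFluxSlope_zero :
    scaledFluxSlope α c 0 = c * (α / 2) * (1 / Real.Gamma (1 - α)) := by
  simp [scaledFluxSlope, h₀.ne']

/-- Continuity at `s = 0` is what the Abel lemmas need; the memory term is evaluated only at
positive arguments, where it is continuous. -/
lemma continuousOn_scaledFluxSlope : ContinuousOn (scaledFluxSlope α c) (Set.Ici 0) := by
  have hp := continuousOn_one_add_rpow
  have hz := continuousOn_const (c := c).mul (hp (-(α / 2)))
  have hR : ContinuousOn (fun s => memoryTerm α c (c * (1 + s) ^ (-(α / 2)))) (Set.Ici 0) := by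
    intro s hs
    have h1 : (0 : ℝ) < 1 + s := by
      have : (0 : ℝ) ≤ s := hs
      linarith
    exact ContinuousAt.comp_continuousWithinAt (g := memoryTerm α c)
      (continuousAt_memoryTerm h₀ h₁ hc.le (mul_pos hc (Real.rpow_pos_of_pos h1 _))) (hz s hs)
  refine ContinuousOn.add (continuousOn_const.div (by fun_prop) fun s hs => ?_) ?_
  · have : (0 : ℝ) ≤ s := hs
    linarith
  · refine (Real.continuous_rpow_const h₀.le).continuousOn.mul (ContinuousOn.sub ?_ ?_)
    · exact (continuousOn_const.mul (hp _)).mul hR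
    · exact (continuousOn_const.mul (hp _)).mul
        ((continuous_fluxProfile h₀ h₁ hc.le).comp_continuousOn hz)

lemma hasDerivAt_scaledFlux {s : ℝ} (hs : 0 < s) :
    HasDerivAt (scaledFlux α c) (s ^ (-α) * scaledFluxSlope α c s) s := by
  have hv : 0 < 1 + s := by linarith
  have hv1 : 1 < 1 + s := by linarith
  set v := 1 + s with hvdef
  have hpow : HasDerivAt (fun s : ℝ => (1 + s) ^ (-(α / 2))) (-(α / 2) * v ^ (-(α / 2) - 1)) s := by
    have := ((hasDerivAt_id s).const_add 1).rpow_const (p := -(α / 2)) (Or.inl hv.ne')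
    simpa using this
  have hlt : v ^ (-(α / 2)) < 1 := Real.rpow_lt_one_of_one_lt_of_neg hv1 (by linarith)
  have hz0 : 0 < c * v ^ (-(α / 2)) := mul_pos hc (Real.rpow_pos_of_pos hv _)
  have hzc : c * v ^ (-(α / 2)) < c := mul_lt_of_lt_one_right hc hlt
  have hg : HasDerivAt (fun s : ℝ => fluxProfile α c (c * (1 + s) ^ (-(α / 2)))) _ s :=
    (hasDerivAt_fluxProfile h₀ h₁ hz0 hzc).comp s (hpow.const_mul c)
  refine (hpow.mul hg).congr_deriv ?_
  -- The only singular contribution to the derivative: the identity `rpow_mul_singularWeight` with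
  -- passage time `1` and time `1 + s`.
  have hw : singularWeight α (c * v ^ (-(α / 2)) / c) = v ^ α * s ^ (-α) := by
    have h := rpow_mul_singularWeight h₀ one_pos hv1
    rw [one_div, Real.inv_rpow hv.le, ← Real.rpow_neg hv.le,
      show v - 1 = s by rw [hvdef]; ring] at h
    rw [mul_div_cancel_left₀ _ hc.ne', ← h, ← mul_assoc, ← Real.rpow_add hv]
    simp
  have e₁ : s ^ (-α) * s ^ α = 1 := by rw [← Real.rpow_add hs]; simp
  have e₂ : v ^ (-(α / 2)) * v ^ (-(α / 2) - 1) = v ^ (-α - 1) := by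
    rw [← Real.rpow_add hv]; congr 1; ring
  have e₃ : v ^ (-α - 1) * v ^ α = 1 / v := by
    rw [← Real.rpow_add hv, show -α - 1 + α = -1 by ring, Real.rpow_neg_one, one_div]
  simp only [scaledFluxSlope, ← hvdef]
  rw [hw]
  set R := memoryTerm α c (c * v ^ (-(α / 2)))
  set g := fluxProfile α c (c * v ^ (-(α / 2)))
  set C := 1 / Real.Gamma (1 - α)
  set P := c * (α / 2) * C
  have hL : -(α / 2) * v ^ (-(α / 2) - 1) * g + v ^ (-(α / 2)) *
      (-(C * (v ^ α * s ^ (-α) + R)) * (c * (-(α / 2) * v ^ (-(α / 2) - 1)))) =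
      -(α / 2) * v ^ (-(α / 2) - 1) * g + P * (v ^ (-(α / 2)) * v ^ (-(α / 2) - 1)) *
        (v ^ α * s ^ (-α) + R) := by
    simp only [P]; ring
  have hR : s ^ (-α) * (P / v + s ^ α * (P * v ^ (-α - 1) * R -
      α / 2 * v ^ (-(α / 2) - 1) * g)) = P * (1 / v) * s ^ (-α) + (s ^ (-α) * s ^ α) *
        (P * v ^ (-α - 1) * R - α / 2 * v ^ (-(α / 2) - 1) * g) := by
    ring
  rw [hL, hR, e₁, e₂, ← e₃]
  ring

/-- The substitution `τ = τ₀ (1 + r θ)` separates the variables: apart from a power of `τ₀`, the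
integral depends on `t` only through `r = t/τ₀ - 1`. -/
lemma fluxIntegral_eq {τ₀ t : ℝ} (hτ₀ : 0 < τ₀) (ht : τ₀ < t) :
    fluxIntegral α (temperature α c) (interfaceCurve α c) (interfaceCurve α c τ₀) t =
      -(τ₀ ^ (α / 2) * abelIntegral α (scaledFlux α c) (t / τ₀ - 1)) := by
  have h := flux_integrand_eqOn h₀ h₁ hc hτ₀ ht
  rw [Set.uIoo_of_le ht.le] at h
  set x := interfaceCurve α c τ₀ with hx
  set r := t / τ₀ - 1 with hr
  have hr0 : 0 < r := by
    have := (one_lt_div hτ₀).2 ht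
    simp only [hr]; linarith
  have htr : t = τ₀ + τ₀ * r := by
    simp only [hr]; field_simp; ring
  rw [fluxIntegral, hx, curveInv_interfaceCurve h₀ hc hτ₀.le, ← hx,
    intervalIntegral.integral_congr_Ioo_of_le ht.le h]
  have hs := intervalIntegral.smul_integral_comp_add_mul (a := 0) (b := 1)
    (fun τ => (t - τ) ^ (α - 1) * -(τ ^ (-(α / 2)) * fluxProfile α c (x * τ ^ (-(α / 2)))))
    (τ₀ * r) τ₀
  rw [mul_zero, add_zero, mul_one, ← htr] at hs
  rw [← hs, smul_eq_mul, abelIntegral, ← neg_mul, ← intervalIntegral.integral_const_mul,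
    ← intervalIntegral.integral_const_mul]
  refine intervalIntegral.integral_congr fun θ hθ => ?_
  rw [Set.uIcc_of_le zero_le_one] at hθ
  have hv : 0 < 1 + r * θ := by
    have := mul_nonneg hr0.le hθ.1
    linarith
  have e₁ : t - (τ₀ + τ₀ * r * θ) = τ₀ * r * (1 - θ) := by rw [htr]; ring
  have e₂ : τ₀ + τ₀ * r * θ = τ₀ * (1 + r * θ) := by ring
  have e₃ : x * (τ₀ * (1 + r * θ)) ^ (-(α / 2)) = c * (1 + r * θ) ^ (-(α / 2)) := by
    rw [Real.mul_rpow hτ₀.le hv.le, ← mul_assoc, hx, interfaceCurve_mul_rpow hτ₀]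
  rw [e₁, e₂, e₃, Real.mul_rpow hτ₀.le hv.le, Real.mul_rpow (by positivity) (by linarith [hθ.2]),
    Real.mul_rpow hτ₀.le hr0.le, scaledFlux]
  have e₄ : r * r ^ (α - 1) = r ^ α := by
    rw [← Real.rpow_one_add' hr0.le (by linarith)]; congr 1; ring
  have e₅ : τ₀ * τ₀ ^ (α - 1) * τ₀ ^ (-(α / 2)) = τ₀ ^ (α / 2) := by
    rw [← Real.rpow_one_add' hτ₀.le (by linarith), ← Real.rpow_add hτ₀]; congr 1; ring
  rw [← e₄, ← e₅]
  ring

lemma hasDerivAt_fluxIntegral {τ₀ t : ℝ} (hτ₀ : 0 < τ₀) (ht : τ₀ < t) :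
    HasDerivAt (fluxIntegral α (temperature α c) (interfaceCurve α c) (interfaceCurve α c τ₀))
      (-(τ₀ ^ (α / 2 - 1) *
        abelDeriv α (scaledFlux α c) (scaledFluxSlope α c) (t / τ₀ - 1))) t := by
  have hr0 : 0 < t / τ₀ - 1 := by
    have := (one_lt_div hτ₀).2 ht
    linarith
  have hlin : HasDerivAt (fun t => t / τ₀ - 1) (1 / τ₀) t :=
    ((hasDerivAt_id t).div_const τ₀).sub_const 1
  have h := (((hasDerivAt_abelIntegral h₀ h₁ (continuousOn_scaledFlux h₀ h₁ hc)
    (continuousOn_scaledFluxSlope h₀ h₁ hc) (fun s hs => hasDerivAt_scaledFlux h₀ h₁ hc hs)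
    hr0).comp t hlin).const_mul (τ₀ ^ (α / 2))).neg
  refine (h.congr_deriv ?_).congr_of_eventuallyEq ?_
  · rw [Real.rpow_sub_one hτ₀.ne']
    ring
  · filter_upwards [lt_mem_nhds ht] with t' ht'
    exact fluxIntegral_eq h₀ h₁ hc hτ₀ ht'

/-- For fixed `t`, letting `a` increase to `s(t)` sends the passage time `T a` to `t`, hence `r = t
/ T a - 1` to `0` from the right, where the limit of `abelDeriv` is known. -/
lemma tendsto_flux {t : ℝ} (ht : 0 < t) :
    Tendsto (fun a => -(1 / Real.Gamma α) *
        deriv (fluxIntegral α (temperature α c) (interfaceCurve α c) a) t)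
      (𝓝[<] (interfaceCurve α c t)) (𝓝 (deriv (interfaceCurve α c) t)) := by
  have hst : 0 < interfaceCurve α c t := interfaceCurve_pos hc ht
  set T : ℝ → ℝ := fun a => (a / c) ^ (2 / α) with hT
  have hTt : T (interfaceCurve α c t) = t := by
    simp only [hT, interfaceCurve]
    rw [mul_div_cancel_left₀ _ hc.ne', ← Real.rpow_mul ht.le,
      show α / 2 * (2 / α) = 1 by field_simp, Real.rpow_one]
  have hTlim : Tendsto T (𝓝[<] (interfaceCurve α c t)) (𝓝 t) := by
    have : Continuous T :=
      (Real.continuous_rpow_const (by positivity)).comp (continuous_id.div_const c)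
    have := this.tendsto (interfaceCurve α c t)
    rw [hTt] at this
    exact this.mono_left nhdsWithin_le_nhds
  have hev : ∀ᶠ a in 𝓝[<] (interfaceCurve α c t), 0 < T a ∧ T a < t ∧
      a = interfaceCurve α c (T a) := by
    filter_upwards [Ioo_mem_nhdsLT hst] with a ha
    have he := interfaceCurve_rpow h₀ hc ha.1.le
    have hpos : 0 < T a := Real.rpow_pos_of_pos (div_pos ha.1 hc) _
    refine ⟨hpos, ?_, he.symm⟩
    exact ((strictMonoOn_interfaceCurve h₀ hc).lt_iff_lt hpos.le ht.le).1 (he.trans_lt ha.2)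
  have hr : Tendsto (fun a => t / T a - 1) (𝓝[<] (interfaceCurve α c t)) (𝓝[>] 0) := by
    refine tendsto_nhdsWithin_iff.2 ⟨?_, ?_⟩
    · have := (tendsto_const_nhds (x := t)).div hTlim ht.ne' |>.sub_const 1
      rwa [div_self ht.ne', sub_self] at this
    · filter_upwards [hev] with a ha
      have := (one_lt_div ha.1).2 ha.2.1
      simp only [Set.mem_Ioi]; linarith
  have hA := (tendsto_abelDeriv h₀ h₁ (continuousOn_scaledFlux h₀ h₁ hc)
    (continuousOn_scaledFluxSlope h₀ h₁ hc) (fun s hs => hasDerivAt_scaledFlux h₀ h₁ hc hs)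
    (scaledFlux_zero hc)).comp hr
  have hP : Tendsto (fun a => T a ^ (α / 2 - 1)) (𝓝[<] (interfaceCurve α c t))
      (𝓝 (t ^ (α / 2 - 1))) :=
    (Real.continuousAt_rpow_const t _ (Or.inl ht.ne')).tendsto.comp hTlim
  have hlim := (hP.mul hA).const_mul (1 / Real.Gamma α)
  rw [(hasDerivAt_interfaceCurve ht).deriv]
  have hΓ := (Real.Gamma_pos_of_pos h₀).ne'
  have hΓ' := (Real.Gamma_pos_of_pos (by linarith : 0 < 1 - α)).ne'
  have hval : 1 / Real.Gamma α * (t ^ (α / 2 - 1) *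
      (scaledFluxSlope α c 0 * (Real.Gamma α * Real.Gamma (1 - α)))) =
      c * (α / 2 * t ^ (α / 2 - 1)) := by
    rw [scaledFluxSlope_zero h₀]
    field_simp
  rw [hval] at hlim
  refine hlim.congr' ?_
  filter_upwards [hev] with a ha
  have := (hasDerivAt_fluxIntegral h₀ h₁ hc ha.1 ha.2.1).deriv
  rw [← ha.2.2] at this
  rw [this, Function.comp_apply]
  ring

lemma isSolution_temperature :
    IsSolution α (temperatureProfile α c 0) (temperature α c) (interfaceCurve α c) where
  datum_pos := temperatureProfile_zero_pos h₀ h₁ hc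
  s_zero := by
    rw [interfaceCurve, Real.zero_rpow (by positivity), mul_zero]
  s_cont := (continuous_interfaceCurve h₀).continuousOn
  s_diff t ht := (hasDerivAt_interfaceCurve ht).differentiableAt
  s_deriv_pos t ht := by
    rw [(hasDerivAt_interfaceCurve ht).deriv]
    positivity
  u_cont := continuousOn_temperature h₀ h₁ hc.le
  u_diff_t x t ht hx hxt := (hasDerivAt_temperature_right h₀ h₁ hc ht hx hxt).differentiableAt
  u_diff_x x t ht hx hxt := (hasDerivAt_temperature_left h₀ h₁ hc ht hx hxt).differentiableAt
  u_diff_xx x t ht hx hxt := (hasDerivAt_dx_temperature h₀ h₁ hc ht hx hxt).differentiableAt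
  caputo_integrable x t ht hx hxt := by
    obtain ⟨τ₀, hτ₀, hτ₀t, rfl⟩ := exists_eq_interfaceCurve h₀ hc ht hx hxt
    rw [curveInv_interfaceCurve h₀ hc hτ₀.le]
    exact (intervalIntegrable_congr_uIoo (caputo_integrand_eqOn h₀ h₁ hc hτ₀ hτ₀t)).2
      (intervalIntegrable_caputo_explicit h₀ h₁ hc _ hτ₀ hτ₀t)
  equation x t ht hx hxt := by
    obtain ⟨τ₀, hτ₀, hτ₀t, rfl⟩ := exists_eq_interfaceCurve h₀ hc ht hx hxt
    -- In `u_xx` the memory term is the Caputo derivative and the singular weight is the source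
    -- term.
    rw [curveInv_interfaceCurve h₀ hc hτ₀.le, caputo_temperature h₀ h₁ hc hτ₀ hτ₀t,
      (hasDerivAt_dx_temperature h₀ h₁ hc ht hx hxt).deriv,
      interfaceCurve_mul_rpow_div hc hτ₀ ht, ← rpow_mul_singularWeight h₀ hτ₀ hτ₀t]
    ring
  interface_zero t ht := by
    rw [temperature_eq h₀ h₁ ht (interfaceCurve_pos hc ht).le le_rfl,
      interfaceCurve_mul_rpow ht, temperatureProfile, intervalIntegral.integral_same]
  dirichlet t ht := by
    rw [temperature_eq h₀ h₁ ht le_rfl (interfaceCurve_pos hc ht).le, zero_mul]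
  flux_integrable a t ht ha hat := by
    obtain ⟨τ₀, hτ₀, hτ₀t, rfl⟩ := exists_eq_interfaceCurve h₀ hc ht ha hat
    rw [curveInv_interfaceCurve h₀ hc hτ₀.le]
    exact intervalIntegrable_flux h₀ h₁ hc hτ₀ hτ₀t
  flux_diff a t ht ha hat := by
    obtain ⟨τ₀, hτ₀, hτ₀t, rfl⟩ := exists_eq_interfaceCurve h₀ hc ht ha hat
    exact (hasDerivAt_fluxIntegral h₀ h₁ hc hτ₀ hτ₀t).differentiableAt
  free_boundary t ht := tendsto_flux h₀ h₁ hc ht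

end Flux

end FractionalStefan

end

theorem corollary1 (α c₁ γ : ℝ) (hα₀ : 0 < α) (hα₁ : α < 1) (hc₁ : 0 < c₁)
    (hγ : γ = ∫ p in (0 : ℝ)..c₁, FractionalStefan.H α p 0 * FractionalStefan.G α c₁ p) :
    FractionalStefan.FormulasConverge α c₁ ∧
      FractionalStefan.IsSolution α γ (FractionalStefan.temperature α c₁)
        (FractionalStefan.interfaceCurve α c₁) := by
  -- At `z = 0` this identifies the datum `γ` with `temperatureProfile α c₁ 0`.
  have h := FractionalStefan.integral_H_mul_G hα₀ hα₁ le_rfl hc₁.le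
  rw [hγ, h]
  exact ⟨FractionalStefan.formulasConverge hα₀ hα₁ hc₁.le,
    FractionalStefan.isSolution_temperature hα₀ hα₁ hc₁⟩
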